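/- In the Orthogonal Vectors problem one is given two families $A, B$ of subsets of $\{1,\dots,d\}$ with $|A| = |B| = n \ge 1$, and has to decide whether there are $a \in A$ and $b \in B$ with $a \cap b = \emptyset$. The computational model is the word RAM with words of $\Theta(d + \log n)$ bits and an instruction that draws a fair random bit; every instruction takes one step. Theorem. (i) There are a constant $\varepsilon > 0$ and a randomized algorithm that solves the Orthogonal Vectors problem in worst-case time $\tilde{O}(1.25^d \cdot n)$, i.e. in at most $C \cdot 1.25^d \cdot n \cdot (d + \log n + 1)^k$ steps for some constants $C, k$, with one-sided error: it never answers "yes" if there is no disjoint pair, and it answers "yes" with probability at least $1 - 2^{-d^{\varepsilon}}$ if there is one. (ii) The running time can be improved to $O(1.16^d \cdot n)$: there are a constant $\varepsilon>0$ and a randomized algorithm with the same one-sided error guarantee and worst-case running time at most $C \cdot 1.16^d \cdot n$ for some constant $C$. -/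

import Mathlib

/-! ### A probabilistic word RAM with a step count

Words have `w` bits and are represented by the natural numbers below `2 ^ w`; every value that
an instruction writes is reduced modulo `2 ^ w`. A program is a finite syntactic object; it uses
finitely many registers and a memory addressed by words. -/

namespace WordRAM

/-- The binary operations on words that take one step. -/
inductive Op
  | add | sub | mul | div | mod | and | or | xor | shl | shr | lt | eq

/-- The value of a binary operation, before reduction modulo `2 ^ w`.
Subtraction stops at `0`, and comparisons return `0` or `1`. -/
def Op.eval : Op → ℕ → ℕ → ℕ
  | .add, a, b => a + b
  | .sub, a, b => a - b
  | .mul, a, b => a * b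
  | .div, a, b => a / b
  | .mod, a, b => a % b
  | .and, a, b => a &&& b
  | .or, a, b => a ||| b
  | .xor, a, b => a ^^^ b
  | .shl, a, b => a <<< b
  | .shr, a, b => a >>> b
  | .lt, a, b => if a < b then 1 else 0
  | .eq, a, b => if a = b then 1 else 0

/-- Programs. Registers are named by natural numbers. -/
inductive Cmd
  /-- do nothing -/
  | skip
  /-- `r := c` -/
  | const (r c : ℕ)
  /-- `r := a op b` for registers `a`, `b` -/
  | op (o : Op) (r a b : ℕ)
  /-- `r := mem[a]`, where the address is the content of register `a` -/
  | load (r a : ℕ)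
  /-- `mem[a] := r`, where the address is the content of register `a` -/
  | store (a r : ℕ)
  /-- put a fresh fair random bit into `r` -/
  | flip (r : ℕ)
  /-- first `c₁`, then `c₂` -/
  | seq (c₁ c₂ : Cmd)
  /-- if register `r` is nonzero then `c₁` else `c₂` -/
  | ite (r : ℕ) (c₁ c₂ : Cmd)
  /-- while register `r` is nonzero do `c` -/
  | loop (r : ℕ) (c : Cmd)

/-- The contents of the registers and of the memory. -/
structure State where
  regs : ℕ → ℕ
  mem : ℕ → ℕ

/-- Write the value `v`, reduced to a `w`-bit word, into register `r`. -/
def State.setReg (w : ℕ) (s : State) (r v : ℕ) : State :=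
  { s with regs := Function.update s.regs r (v % 2 ^ w) }

/-- Write the value `v`, reduced to a `w`-bit word, into the memory cell `a`. -/
def State.setMem (w : ℕ) (s : State) (a v : ℕ) : State :=
  { s with mem := Function.update s.mem a (v % 2 ^ w) }

/-- A configuration: the stack of commands still to be executed, and the current state.
The machine has halted when the stack is empty. -/
abbrev Config := List Cmd × State

/-- One step of the machine with `w`-bit words. -/
noncomputable def step (w : ℕ) : Config → PMF Config
  | ([], s) => PMF.pure ([], s)
  | (.skip :: k, s) => PMF.pure (k, s)
  | (.const r c :: k, s) => PMF.pure (k, s.setReg w r c)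
  | (.op o r a b :: k, s) => PMF.pure (k, s.setReg w r (o.eval (s.regs a) (s.regs b)))
  | (.load r a :: k, s) => PMF.pure (k, s.setReg w r (s.mem (s.regs a)))
  | (.store a r :: k, s) => PMF.pure (k, s.setMem w (s.regs a) (s.regs r))
  | (.flip r :: k, s) =>
      (PMF.uniformOfFintype Bool).map fun b => (k, s.setReg w r (if b then 1 else 0))
  | (.seq c₁ c₂ :: k, s) => PMF.pure (c₁ :: c₂ :: k, s)
  | (.ite r c₁ c₂ :: k, s) => PMF.pure (if s.regs r ≠ 0 then (c₁ :: k, s) else (c₂ :: k, s))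
  | (.loop r c :: k, s) =>
      PMF.pure (if s.regs r ≠ 0 then (c :: .loop r c :: k, s) else (k, s))

/-- The distribution of the configuration after `t` steps. -/
noncomputable def run (w : ℕ) : ℕ → Config → PMF Config
  | 0, c => PMF.pure c
  | t + 1, c => (step w c).bind (run w t)

/-- Whatever the random bits are, the machine has halted after at most `t` steps. -/
def HaltsWithin (w t : ℕ) (c : Config) : Prop :=
  ∀ c' ∈ (run w t c).support, c'.1 = []

/-- The probability that the machine has halted after at most `t` steps with answer "yes",
that is, with a nonzero value in register `0`. -/
noncomputable def acceptProb (w t : ℕ) (c : Config) : ℝ :=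
  ((run w t c).toOuterMeasure {c' | c'.1 = [] ∧ c'.2.regs 0 ≠ 0}).toReal

end WordRAM

namespace OrthogonalVectors

open WordRAM

/-- The question: is there a disjoint pair, one set from each family? -/
def HasOrthogonalPair {n d : ℕ} (A B : Fin n → Finset (Fin d)) : Prop :=
  ∃ i j, Disjoint (A i) (B j)

/-- The memory holding an instance: `n`, then `d`, then the characteristic vectors of the sets
of `A`, one bit per cell, then those of `B`; all other cells are `0`. -/
def inputMem {n d : ℕ} (A B : Fin n → Finset (Fin d)) (x : ℕ) : ℕ :=
  if x = 0 then n
  else if x = 1 then d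
  else if (∃ i : Fin n, ∃ j : Fin d, x = 2 + i * d + j ∧ j ∈ A i) ∨
      (∃ i : Fin n, ∃ j : Fin d, x = 2 + n * d + i * d + j ∧ j ∈ B i) then 1
  else 0

/-- The initial configuration of the program `P` on the instance `(A, B)`. -/
def initConfig (P : Cmd) {n d : ℕ} (A B : Fin n → Finset (Fin d)) : Config :=
  ([P], ⟨fun _ => 0, inputMem A B⟩)

/-- The program `P` decides the Orthogonal Vectors problem, on every word RAM whose word length
is at least `κ * (d + log n + 1)`, in worst-case time `time n d`, never answering "yes" on a
no-instance, and answering "yes" on a yes-instance with probability at least `1 - err d`.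
The two families consist of `n` distinct sets each, listed in an arbitrary order. -/
def Decides (P : Cmd) (κ : ℕ) (time : ℕ → ℕ → ℝ) (err : ℕ → ℝ) : Prop :=
  ∀ (n d w : ℕ) (A B : Fin n → Finset (Fin d)), 1 ≤ n →
    Function.Injective A → Function.Injective B → κ * (d + Nat.log 2 n + 1) ≤ w →
    ∃ t : ℕ, (t : ℝ) ≤ time n d ∧
      HaltsWithin w t (initConfig P A B) ∧
      (¬ HasOrthogonalPair A B → acceptProb w t (initConfig P A B) = 0) ∧
      (HasOrthogonalPair A B → 1 - err d ≤ acceptProb w t (initConfig P A B))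

end OrthogonalVectors

/-! A deterministic program that never errs achieves `O(1.16 ^ d * n)`, and both parts follow from
it. Attach to every set `a` a list `F a` and to every set `b` a list `G b` so that the two lists
share an entry exactly when `a` and `b` are disjoint. Marking all entries for `A` in memory and then
looking up all entries for `B` decides the problem in time `n` times the list length, up to the cost
of computing an entry; memory beyond the input starts at zero, so no initialisation is paid for.

An entry is a set `S`: it belongs to `F a` if `a ⊆ S` and to `G b` if `S` misses `b`, so a common
entry certifies disjointness. For sizes `i, j` in a ground set of `m = u + i + j` points, sample
sets `S` of size `i + k`, where `u = k + l`. A disjoint pair is separated by `C(u, k)` of them,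
while `a` lies in `C(u + j, k)` and `b` is missed by `C(u + i, l)`. Enough samples to hit every pair
therefore give lists whose length is, up to a polynomial factor, the larger ratio of these numbers
to `C(u, k)`. A suitable split of `u` makes both ratios at most `1.1598 ^ m` up to a polynomial
(`exists_balanced_choose`), and the probabilistic method yields the family (`exists_sequence`,
`exists_separating_family`).

The family is not built at run time. One constant `m` is fixed for which the lists have length at
most `1.1599 ^ m` (`exists_cover`), and its table is hard-wired into the program as a single number.
A vector of length `d` is cut into `d / m + 1` blocks, and its list consists of all combinations of
entries of the lists of its blocks (`exists_nodeCode_eq_iff`), so it has length `O(1.1599 ^ d)`.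
Computing one entry costs `O(d + 1)`, which the gap between `1.1599` and `1.16` absorbs (`time_le`).
The remaining lemmas verify the program instruction by instruction. -/

/-! ### Ratios of binomial coefficients -/

namespace BinomialRatio

/-- The binomial distribution on `u` trials with success probability `p / (p + p')` has an atom
of mass at least `1 / (u + 1)` close to its mean. -/
lemma exists_mode (u p p' : ℕ) (hp : 0 < p) (hp' : 0 < p') :
    ∃ k l : ℕ, k + l = u ∧
      (1 : ℝ) ≤ (u + 1) * u.choose k * ((p : ℝ) / (p + p')) ^ k * ((p' : ℝ) / (p + p')) ^ l ∧
      p' * k ≤ p * l + (p + p') ∧ p * l ≤ p' * k + (p + p') := by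
  set a : ℝ := (p : ℝ) / (p + p') with ha
  set b : ℝ := (p' : ℝ) / (p + p') with hb
  have hp0 : (0 : ℝ) < p := by exact_mod_cast hp
  have hp'0 : (0 : ℝ) < p' := by exact_mod_cast hp'
  have ha0 : 0 < a := by positivity
  have hb0 : 0 < b := by positivity
  have hab : a + b = 1 := by rw [ha, hb]; field_simp
  let f : ℕ → ℝ := fun k => a ^ k * b ^ (u - k) * u.choose k
  obtain ⟨k, hk, hmax⟩ := Finset.exists_max_image (Finset.range (u + 1)) f ⟨0, by simp⟩
  have hku : k ≤ u := Nat.lt_succ_iff.mp (Finset.mem_range.mp hk)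
  obtain ⟨l, rfl⟩ := Nat.exists_eq_add_of_le hku
  have hfk : f k = a ^ k * b ^ l * (k + l).choose k := by simp [f]
  have hC : (0 : ℝ) < (k + l).choose k := by exact_mod_cast Nat.choose_pos (by omega)
  have conv : ∀ {x y : ℕ} , (x : ℝ) * a ≤ y * b → p * x ≤ p' * y := by
    intro x y h
    have : (x : ℝ) * p ≤ y * p' := by
      have h2 := mul_le_mul_of_nonneg_right h (by positivity : (0 : ℝ) ≤ p + p')
      rw [ha, hb] at h2
      field_simp at h2
      linarith
    rw [mul_comm p, mul_comm p']
    exact_mod_cast this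
  have conv' : ∀ {x y : ℕ} , (x : ℝ) * b ≤ y * a → p' * x ≤ p * y := by
    intro x y h
    have : (x : ℝ) * p' ≤ y * p := by
      have h2 := mul_le_mul_of_nonneg_right h (by positivity : (0 : ℝ) ≤ p + p')
      rw [ha, hb] at h2
      field_simp at h2
      linarith
    rw [mul_comm p, mul_comm p']
    exact_mod_cast this
  refine ⟨k, l, rfl, ?_, ?_, ?_⟩
  -- The `u + 1` atoms sum to `1`, so the largest is at least `1 / (u + 1)`; comparing it with its
  -- two neighbours locates it.
  · have h1 : ∑ i ∈ Finset.range (k + l + 1), f i = 1 := by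
      have := add_pow a b (k + l)
      rw [hab, one_pow] at this
      exact this.symm
    have h2 := Finset.sum_le_card_nsmul (Finset.range (k + l + 1)) f (f k) hmax
    rw [h1, hfk] at h2
    simp only [Finset.card_range, nsmul_eq_mul] at h2
    push_cast at h2 ⊢
    linarith
  · rcases Nat.eq_zero_or_pos k with rfl | hkpos
    · omega
    obtain ⟨k, rfl⟩ := Nat.exists_eq_succ_of_ne_zero hkpos.ne'
    have h := hmax k (Finset.mem_range.mpr (by omega))
    rw [hfk] at h
    have e : k + 1 + l - k = l + 1 := by omega
    simp only [f, Nat.succ_eq_add_one, e] at h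
    have hid := Nat.choose_succ_right_eq (k + 1 + l) k
    rw [e] at hid
    have hid' : ((k + 1 + l).choose (k + 1) : ℝ) * (k + 1) = (k + 1 + l).choose k * (l + 1) := by
      exact_mod_cast hid
    have h3 : b * (k + 1 + l).choose k ≤ a * (k + 1 + l).choose (k + 1) := by
      have hpos : 0 < a ^ k * b ^ l := by positivity
      rw [pow_succ, pow_succ] at h
      nlinarith
    have h4 : ((k + 1 : ℕ) : ℝ) * b ≤ ((l + 1 : ℕ) : ℝ) * a := by
      push_cast
      have h5 := mul_le_mul_of_nonneg_right h3 (by positivity : (0 : ℝ) ≤ (k : ℝ) + 1)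
      have hC' : (0 : ℝ) < (k + 1 + l).choose k := by exact_mod_cast Nat.choose_pos (by omega)
      refine le_of_mul_le_mul_left ?_ hC'
      calc _ = b * (k + 1 + l).choose k * ((k : ℝ) + 1) := by ring
        _ ≤ _ := h5
        _ = a * ((k + 1 + l).choose (k + 1) * (k + 1)) := by ring
        _ = _ := by rw [hid']; ring
    have := conv' h4
    simp only [Nat.succ_eq_add_one]
    nlinarith
  · rcases Nat.eq_zero_or_pos l with rfl | hlpos
    · omega
    obtain ⟨l, rfl⟩ := Nat.exists_eq_succ_of_ne_zero hlpos.ne'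
    have h := hmax (k + 1) (Finset.mem_range.mpr (by omega))
    rw [hfk] at h
    have e : k + (l + 1) - (k + 1) = l := by omega
    have e' : k + (l + 1) - k = l + 1 := by omega
    simp only [f, Nat.succ_eq_add_one, e] at h
    have hid := Nat.choose_succ_right_eq (k + (l + 1)) k
    rw [e'] at hid
    have hid' : ((k + (l + 1)).choose (k + 1) : ℝ) * (k + 1)
        = (k + (l + 1)).choose k * (l + 1) := by exact_mod_cast hid
    have h3 : a * (k + (l + 1)).choose (k + 1) ≤ b * (k + (l + 1)).choose k := by
      have hpos : 0 < a ^ k * b ^ l := by positivity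
      rw [pow_succ, pow_succ] at h
      nlinarith
    have h4 : ((l + 1 : ℕ) : ℝ) * a ≤ ((k + 1 : ℕ) : ℝ) * b := by
      push_cast
      have h5 := mul_le_mul_of_nonneg_right h3 (by positivity : (0 : ℝ) ≤ (k : ℝ) + 1)
      refine le_of_mul_le_mul_left ?_ hC
      calc _ = a * ((k + (l + 1)).choose k * (l + 1)) := by simp only [Nat.succ_eq_add_one]; ring
        _ = a * (k + (l + 1)).choose (k + 1) * (k + 1) := by rw [← hid']; ring
        _ ≤ _ := h5
        _ = _ := by simp only [Nat.succ_eq_add_one]; ring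
    have := conv h4
    simp only [Nat.succ_eq_add_one]
    nlinarith

/-- If `b ≤ a` and `k / (k + l)` exceeds `p / (p + p')` by little, then the geometric mean of `a, b`
with weights `k, l` exceeds the one with weights `p, p'` by little. -/
lemma pow_mul_pow_le {p p' k l : ℕ} {a b ρ : ℝ} (hp : 0 < p) (ha : 0 < a) (hb : 0 < b)
    (hρ : 0 < ρ) (hab : b ≤ a) (hk : p' * k ≤ p * l + (p + p'))
    (h : a ^ p * b ^ p' ≤ ρ ^ (p + p')) : a ^ k * b ^ l ≤ a / b * ρ ^ (k + l) := by
  have hl := Real.log_le_log (by positivity) h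
  rw [Real.log_mul (by positivity) (by positivity), Real.log_pow, Real.log_pow, Real.log_pow] at hl
  have hAB : Real.log b ≤ Real.log a := Real.log_le_log hb hab
  rw [← Real.log_le_log_iff (by positivity) (by positivity), Real.log_mul (by positivity)
    (by positivity), Real.log_mul (by positivity) (by positivity), Real.log_div ha.ne' hb.ne',
    Real.log_pow, Real.log_pow, Real.log_pow]
  have hk' : (p' : ℝ) * k ≤ p * l + (p + p') := by exact_mod_cast hk
  have hp0 : (0 : ℝ) < p := by exact_mod_cast hp
  push_cast at *
  have h1 := mul_le_mul_of_nonneg_left hl (by positivity : (0 : ℝ) ≤ k + l)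
  have h2 := mul_le_mul_of_nonneg_right hk' (sub_nonneg.mpr hAB)
  -- With `α = log a`, `β = log b`: `(p + p')(kα + lβ) = (k + l)(pα + p'β) + (p'k - pl)(α - β)`, and
  -- `p'k - pl ≤ p + p'`.
  refine le_of_mul_le_mul_left ?_ (by positivity : (0 : ℝ) < p + p')
  nlinarith

lemma choose_mul_pow_le_one (u k : ℕ) {x x' : ℝ} (hx : 0 ≤ x) (hx' : 0 ≤ x') (h : x + x' = 1) :
    ((u.choose k : ℕ) : ℝ) * x ^ k * x' ^ (u - k) ≤ 1 := by
  rcases le_or_gt k u with hk | hk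
  · have h1 := add_pow x x' u
    rw [h, one_pow] at h1
    rw [h1]
    have := Finset.single_le_sum (f := fun m => x ^ m * x' ^ (u - m) * (u.choose m : ℝ))
      (fun i _ => by positivity) (Finset.mem_range.mpr (Nat.lt_succ_of_le hk))
    calc _ = x ^ k * x' ^ (u - k) * (u.choose k : ℝ) := by ring
      _ ≤ _ := this
  · simp [Nat.choose_eq_zero_of_lt hk]

/-- The large coefficient is bounded above by a single term of the binomial expansion of `(x + x') ^
(k + l + j) = 1`, the small one below by its being a mode for the bias `p / (p + p')`. The quotient
consists of a relative-entropy factor, controlled by `h`, and of `x' ^ (-j)`, controlled by `hj`. -/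
lemma choose_add_le {p p' k l j n : ℕ} {x x' ρ : ℝ} (hp : 0 < p) (hp' : 0 < p') (hx : 0 < x)
    (hx' : 0 < x') (hxx : x + x' = 1) (hρ : 0 < ρ) (hle : x * p' ≤ x' * p)
    (hk : p' * k ≤ p * l + (p + p'))
    (hmode : (1 : ℝ) ≤ ((k + l : ℕ) + 1) * (k + l).choose k * ((p : ℝ) / (p + p')) ^ k *
      ((p' : ℝ) / (p + p')) ^ l)
    (h : ((p : ℝ) / (p + p') / x) ^ p * ((p' : ℝ) / (p + p') / x') ^ p' ≤ ρ ^ (p + p'))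
    (hj : 1 ≤ ρ ^ n * x' ^ j) :
    ((k + l + j).choose k : ℝ) ≤ (p * x' / (p' * x)) * ((k + l : ℕ) + 1) * ρ ^ (k + l + n) *
      (k + l).choose k := by
  have hp0 : (0 : ℝ) < p := by exact_mod_cast hp
  have hp'0 : (0 : ℝ) < p' := by exact_mod_cast hp'
  have hba : (p' : ℝ) / (p + p') / x' ≤ (p : ℝ) / (p + p') / x := by
    rw [div_div, div_div, div_le_div_iff₀ (by positivity) (by positivity)]
    nlinarith
  have hz := pow_mul_pow_le (k := k) (l := l) hp (by positivity) (by positivity) hρ hba hk h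
  have hone := choose_mul_pow_le_one (k + l + j) k hx.le hx'.le hxx
  have e : k + l + j - k = l + j := by omega
  rw [e, pow_add] at hone
  have hw : 0 < x ^ k * x' ^ l := by positivity
  set C := ((k + l).choose k : ℝ)
  set C' := ((k + l + j).choose k : ℝ)
  have hC : 0 ≤ C := by positivity
  have hC' : 0 ≤ C' := by positivity
  have hr : (p : ℝ) / (p + p') / x / ((p' : ℝ) / (p + p') / x') = p * x' / (p' * x) := by
    field_simp
  rw [hr, div_pow _ x, div_pow _ x', div_mul_div_comm, div_le_iff₀ hw] at hz
  have h1 : C' * x' ^ j * (x ^ k * x' ^ l) ≤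
      (p * x' / (p' * x)) * ((k + l : ℕ) + 1) * ρ ^ (k + l) * C * (x ^ k * x' ^ l) := by
    calc _ = C' * x ^ k * (x' ^ l * x' ^ j) := by ring
      _ ≤ 1 := hone
      _ ≤ _ := hmode
      _ = ((k + l : ℕ) + 1) * C *
        (((p : ℝ) / (p + p')) ^ k * ((p' : ℝ) / (p + p')) ^ l) := by ring
      _ ≤ ((k + l : ℕ) + 1) * C * _ := mul_le_mul_of_nonneg_left hz (by positivity)
      _ = _ := by ring
  have h2 := le_of_mul_le_mul_right h1 hw
  calc C' = C' * 1 := by ring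
    _ ≤ C' * (ρ ^ n * x' ^ j) := mul_le_mul_of_nonneg_left hj hC'
    _ = ρ ^ n * (C' * x' ^ j) := by ring
    _ ≤ ρ ^ n * _ := mul_le_mul_of_nonneg_left h2 (by positivity)
    _ = _ := by rw [pow_add]; ring

lemma one_le_pow_mul_pow {x ρ : ℝ} {n j P R : ℕ} (hx : 0 < x) (hx1 : x ≤ 1) (hρ : 0 < ρ)
    (hP : P ≠ 0) (hj : P * j ≤ R * n) (h : 1 ≤ ρ ^ P * x ^ R) : 1 ≤ ρ ^ n * x ^ j := by
  rw [← one_le_pow_iff_of_nonneg (by positivity) hP]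
  calc (1 : ℝ) ≤ (ρ ^ P * x ^ R) ^ n := one_le_pow₀ h
    _ = ρ ^ (n * P) * x ^ (R * n) := by ring
    _ ≤ ρ ^ (n * P) * x ^ (P * j) :=
      mul_le_mul_of_nonneg_left (pow_le_pow_of_le_one hx.le hx1 hj) (by positivity)
    _ = _ := by ring

/-- Numerical data `x < p / (p + p') < y` that yield balanced binomial ratios for all sizes `i, j`
with `i / (i + j)` between `1 - R / P` and `R' / P`. -/
lemma balanced_choose_of_params {p p' P R R' : ℕ} {x y ρ : ℝ} (hp : 0 < p) (hp' : 0 < p')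
    (hx : 0 < x) (hx1 : x < 1) (hy : 0 < y) (hy1 : y < 1) (hρ : 0 < ρ) (hP : P ≠ 0)
    (hxp : x * p' ≤ (1 - x) * p) (hyp : (1 - y) * p ≤ y * p')
    (hX : ((p : ℝ) / (p + p') / x) ^ p * ((p' : ℝ) / (p + p') / (1 - x)) ^ p' ≤ ρ ^ (p + p'))
    (hY : ((p : ℝ) / (p + p') / y) ^ p * ((p' : ℝ) / (p + p') / (1 - y)) ^ p' ≤ ρ ^ (p + p'))
    (hR : 1 ≤ ρ ^ P * (1 - x) ^ R) (hR' : 1 ≤ ρ ^ P * y ^ R') :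
    ∃ D : ℝ, 0 ≤ D ∧ ∀ u i j : ℕ, P * j ≤ R * (i + j) → P * i ≤ R' * (i + j) →
      ∃ k l : ℕ, k + l = u ∧
        ((u + j).choose k : ℝ) ≤ D * (u + 1) * ρ ^ (u + (i + j)) * u.choose k ∧
        ((u + i).choose l : ℝ) ≤ D * (u + 1) * ρ ^ (u + (i + j)) * u.choose k := by
  have hx1' : 0 < 1 - x := by linarith
  have hy1' : 0 < 1 - y := by linarith
  refine ⟨p * (1 - x) / (p' * x) + p' * y / (p * (1 - y)), by positivity,
    fun u i j hj hi => ?_⟩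
  obtain ⟨k, l, rfl, hmode, hk, hl⟩ := exists_mode u p p' hp hp'
  have hsymm : (k + l).choose k = (l + k).choose l := by
    rw [add_comm l k]; exact Nat.choose_symm_add
  refine ⟨k, l, rfl, ?_, ?_⟩
  · refine (choose_add_le (n := i + j) hp hp' hx hx1' (by ring) hρ hxp hk hmode hX
      (one_le_pow_mul_pow hx1' (by linarith) hρ hP hj hR)).trans ?_
    gcongr
    exact le_add_of_nonneg_right (by positivity)
  -- The second ratio is the first one with the roles of `k, l` and of `p, p'` exchanged and with
  -- bias `1 - y` in place of `x`.
  · have := choose_add_le (n := i + j) (j := i) (k := l) (l := k) hp' hp hy1' hy (by ring) hρ hyp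
      (by omega)
      (by rw [← hsymm, add_comm l k, add_comm (p' : ℝ) p]; refine hmode.trans_eq ?_; ring)
      (by rw [add_comm (p' : ℝ) p, add_comm p' p, mul_comm]; exact hY)
      (one_le_pow_mul_pow hy hy1.le hρ hP hi hR')
    rw [← hsymm, add_comm l k] at this
    refine this.trans ?_
    gcongr
    exact le_add_of_nonneg_left (by positivity)

/-- For all sizes `u, i, j` there is a split of `u` for which both ratios of binomial coefficients
are at most `1.1598 ^ (u + i + j)`, up to a polynomial factor. -/
theorem exists_balanced_choose : ∃ D : ℝ, 0 ≤ D ∧ ∀ u i j : ℕ, ∃ k l : ℕ, k + l = u ∧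
    ((u + j).choose k : ℝ) ≤ D * (u + 1) * 1.1598 ^ (u + i + j) * u.choose k ∧
    ((u + i).choose l : ℝ) ≤ D * (u + 1) * 1.1598 ^ (u + i + j) * u.choose k := by
  have half : ∃ D : ℝ, 0 ≤ D ∧ ∀ u i j : ℕ, j ≤ i → ∃ k l : ℕ, k + l = u ∧
      ((u + j).choose k : ℝ) ≤ D * (u + 1) * 1.1598 ^ (u + (i + j)) * u.choose k ∧
      ((u + i).choose l : ℝ) ≤ D * (u + 1) * 1.1598 ^ (u + (i + j)) * u.choose k := by
    -- At `i = j` the choice `p = p'`, `x = 1/4`, `y = 3/4` would give the base `2 / √3 ≈ 1.1547`.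
    -- The excess in `1.1598` lets five numerical choices cover all proportions `i / (i + j)` from
    -- `1/2` to `1`; `R'` is the upper end of each interval in percent and `R` is `100` minus its
    -- lower end.
    obtain ⟨D₁, p₁, h₁⟩ := balanced_choose_of_params (p := 1) (p' := 1) (P := 100) (R := 50)
      (R' := 52) (x := 0.256) (y := 0.752) (ρ := 1.1598) (by norm_num) (by norm_num) (by norm_num)
      (by norm_num) (by norm_num) (by norm_num) (by norm_num) (by norm_num) (by norm_num)
      (by norm_num) (by norm_num) (by norm_num) (by norm_num) (by norm_num)
    obtain ⟨D₂, p₂, h₂⟩ := balanced_choose_of_params (p := 26) (p' := 24) (P := 100) (R := 48)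
      (R' := 56) (x := 0.265) (y := 0.768) (ρ := 1.1598) (by norm_num) (by norm_num) (by norm_num)
      (by norm_num) (by norm_num) (by norm_num) (by norm_num) (by norm_num) (by norm_num)
      (by norm_num) (by norm_num) (by norm_num) (by norm_num) (by norm_num)
    obtain ⟨D₃, p₃, h₃⟩ := balanced_choose_of_params (p := 27) (p' := 23) (P := 100) (R := 44)
      (R' := 61) (x := 0.286) (y := 0.785) (ρ := 1.1598) (by norm_num) (by norm_num) (by norm_num)
      (by norm_num) (by norm_num) (by norm_num) (by norm_num) (by norm_num) (by norm_num)
      (by norm_num) (by norm_num) (by norm_num) (by norm_num) (by norm_num)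
    obtain ⟨D₄, p₄, h₄⟩ := balanced_choose_of_params (p := 29) (p' := 21) (P := 100) (R := 39)
      (R' := 72) (x := 0.316) (y := 0.814) (ρ := 1.1598) (by norm_num) (by norm_num) (by norm_num)
      (by norm_num) (by norm_num) (by norm_num) (by norm_num) (by norm_num) (by norm_num)
      (by norm_num) (by norm_num) (by norm_num) (by norm_num) (by norm_num)
    obtain ⟨D₅, p₅, h₅⟩ := balanced_choose_of_params (p := 33) (p' := 17) (P := 100) (R := 28)
      (R' := 100) (x := 0.411) (y := 0.863) (ρ := 1.1598) (by norm_num) (by norm_num) (by norm_num)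
      (by norm_num) (by norm_num) (by norm_num) (by norm_num) (by norm_num) (by norm_num)
      (by norm_num) (by norm_num) (by norm_num) (by norm_num) (by norm_num)
    refine ⟨D₁ + D₂ + D₃ + D₄ + D₅, by positivity, fun u i j hij => ?_⟩
    have key : ∀ D : ℝ, D ≤ D₁ + D₂ + D₃ + D₄ + D₅ → (∃ k l : ℕ, k + l = u ∧
        ((u + j).choose k : ℝ) ≤ D * (u + 1) * 1.1598 ^ (u + (i + j)) * u.choose k ∧
        ((u + i).choose l : ℝ) ≤ D * (u + 1) * 1.1598 ^ (u + (i + j)) * u.choose k) →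
        ∃ k l : ℕ, k + l = u ∧
        ((u + j).choose k : ℝ) ≤ (D₁ + D₂ + D₃ + D₄ + D₅) * (u + 1) * 1.1598 ^ (u + (i + j)) *
          u.choose k ∧
        ((u + i).choose l : ℝ) ≤ (D₁ + D₂ + D₃ + D₄ + D₅) * (u + 1) * 1.1598 ^ (u + (i + j)) *
          u.choose k := by
      rintro D hD ⟨k, l, hkl, h, h'⟩
      refine ⟨k, l, hkl, h.trans ?_, h'.trans ?_⟩ <;> gcongr
    rcases le_or_gt (100 * i) (52 * (i + j)) with c₁ | c₁
    · exact key D₁ (by linarith) (h₁ u i j (by omega) c₁)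
    rcases le_or_gt (100 * i) (56 * (i + j)) with c₂ | c₂
    · exact key D₂ (by linarith) (h₂ u i j (by omega) c₂)
    rcases le_or_gt (100 * i) (61 * (i + j)) with c₃ | c₃
    · exact key D₃ (by linarith) (h₃ u i j (by omega) c₃)
    rcases le_or_gt (100 * i) (72 * (i + j)) with c₄ | c₄
    · exact key D₄ (by linarith) (h₄ u i j (by omega) c₄)
    · exact key D₅ (by linarith) (h₅ u i j (by omega) (by omega))
  obtain ⟨D, hD, h⟩ := half
  refine ⟨D, hD, fun u i j => ?_⟩
  rcases le_total j i with hij | hij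
  · simpa only [add_assoc] using h u i j hij
  · obtain ⟨k, l, rfl, h1, h2⟩ := h u j i hij
    refine ⟨l, k, add_comm _ _, ?_, ?_⟩
    · rw [← Nat.choose_symm_add, add_assoc (k + l) i j, add_comm i j]
      simpa only [Nat.choose_symm_add] using h2
    · rw [← Nat.choose_symm_add, add_assoc (k + l) i j, add_comm i j]
      simpa only [Nat.choose_symm_add] using h1

end BinomialRatio

/-! ### Biclique covers of the disjointness matrix -/

namespace DisjointnessCover

open Finset

/-- Independence of the `N` samples, in counting form. The weights `0, 1` count the sequences that
avoid `p`; the weights `2, 1` give the exponential moment of the number of visits to `p`. -/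
lemma sum_piFinset_prod_ite {α : Type*} (Ω : Finset α) (p : α → Prop) [DecidablePred p]
    (x y : ℝ) (N : ℕ) :
    ∑ F ∈ Fintype.piFinset (fun _ : Fin N => Ω), ∏ n, (if p (F n) then x else y) =
      (#(Ω.filter p) * x + ((#Ω : ℝ) - #(Ω.filter p)) * y) ^ N := by
  rw [← Finset.prod_univ_sum (fun _ : Fin N => Ω) (fun _ a => if p a then x else y)]
  simp only [prod_const, card_univ, Fintype.card_fin]
  congr 1
  rw [sum_ite, sum_const, sum_const, nsmul_eq_mul, nsmul_eq_mul]
  have := card_filter_add_card_filter_not (s := Ω) p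
  have : (#(Ω.filter p) : ℝ) + #(Ω.filter fun a => ¬ p a) = #Ω := by exact_mod_cast this
  rw [← this]
  ring

/-- A random sequence hits all the large sets `P i` and visits none of the small sets `Q c` often. -/
theorem exists_sequence {α ι κ : Type*} [Fintype ι] [Fintype κ] (Ω : Finset α)
    (P : ι → α → Prop) (Q : κ → α → Prop) [∀ i, DecidablePred (P i)] [∀ c, DecidablePred (Q c)]
    {m a K : ℕ} {X : ℝ} (hΩ : 0 < #Ω) (ha : 0 < a) (hX : 0 ≤ X)
    (hP : ∀ i, a ≤ #(Ω.filter (P i))) (hQ : ∀ c, (#(Ω.filter (Q c)) : ℝ) ≤ X * a)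
    (hι : Fintype.card ι ≤ 4 ^ m) (hκ : Fintype.card κ ≤ 2 ^ (m + 1))
    (hK : 2 * ((2 * m + 1) * X + 1) + m + 3 ≤ K) :
    ∃ (N : ℕ) (S : Fin N → α), (∀ n, S n ∈ Ω) ∧ (∀ i, ∃ n, P i (S n)) ∧
      ∀ c, #(univ.filter fun n => Q c (S n)) ≤ K := by
  set M : ℝ := (#Ω : ℝ) with hM
  have hM0 : 0 < M := by rw [hM]; exact_mod_cast hΩ
  have ha0 : (0 : ℝ) < a := by exact_mod_cast ha
  -- With this many uniform samples a set of size at least `a` is missed with probability at most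
  -- `exp (-(2m + 1))`, small enough for a union bound over `4 ^ m` sets.
  set N := ⌈(2 * m + 1) * (M / a)⌉₊ with hN
  have hN1 : (2 * m + 1) * (M / a) ≤ N := Nat.le_ceil _
  have hN2 : (N : ℝ) ≤ (2 * m + 1) * (M / a) + 1 := (Nat.ceil_lt_add_one (by positivity)).le
  have hexp1 : Real.exp (-(2 * m + 1)) * 4 ^ m ≤ 1 / 2 := by
    have h1 : Real.exp (-(2 * m + 1)) = Real.exp (-1) * Real.exp (-1) ^ m * Real.exp (-1) ^ m := by
      rw [← Real.exp_nat_mul, ← Real.exp_add, ← Real.exp_add]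
      congr 1; ring
    have h2 : Real.exp (-1) ≤ 1 / 2 := by
      have := Real.exp_neg_one_lt_d9
      linarith
    have h0 := Real.exp_pos (-1)
    rw [h1]
    calc Real.exp (-1) * Real.exp (-1) ^ m * Real.exp (-1) ^ m * 4 ^ m
        ≤ (1 / 2) * (1 / 2) ^ m * (1 / 2) ^ m * 4 ^ m := by gcongr
      _ = (1 / 2) * ((1 / 2) * (1 / 2) * 4) ^ m := by rw [mul_pow, mul_pow]; ring
      _ = 1 / 2 := by norm_num
  have hmiss : ∀ i, ∑ F ∈ Fintype.piFinset (fun _ : Fin N => Ω),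
      ∏ n, (if P i (F n) then (0 : ℝ) else 1) ≤ M ^ N * Real.exp (-(2 * m + 1)) := by
    intro i
    rw [sum_piFinset_prod_ite, ← hM]
    have h1 : (a : ℝ) ≤ #(Ω.filter (P i)) := by exact_mod_cast hP i
    have h2 : (#(Ω.filter (P i)) : ℝ) ≤ M := by
      rw [hM]; exact_mod_cast card_filter_le _ _
    have h3 : #(Ω.filter (P i)) * (0 : ℝ) + (M - #(Ω.filter (P i))) * 1 ≤
        M * Real.exp (-(a / M)) := by
      have := Real.one_sub_le_exp_neg (a / M)
      calc _ ≤ M - a := by linarith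
        _ = M * (1 - a / M) := by field_simp
        _ ≤ _ := mul_le_mul_of_nonneg_left this hM0.le
    calc _ ≤ (M * Real.exp (-(a / M))) ^ N := pow_le_pow_left₀ (by linarith) h3 N
      _ = M ^ N * Real.exp (-(N * (a / M))) := by
        rw [mul_pow, ← Real.exp_nat_mul]; congr 2; ring
      _ ≤ _ := by
        gcongr
        calc (2 * (m : ℝ) + 1) = (2 * m + 1) * (M / a) * (a / M) := by field_simp
          _ ≤ _ := by gcongr
  have hdeg : ∀ c, ∑ F ∈ Fintype.piFinset (fun _ : Fin N => Ω),
      ∏ n, (if Q c (F n) then (2 : ℝ) else 1) ≤ M ^ N * Real.exp ((2 * m + 1) * X + 1) := by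
    intro c
    rw [sum_piFinset_prod_ite, ← hM]
    set b : ℝ := ((#(Ω.filter (Q c)) : ℕ) : ℝ) with hb
    have h1 : b ≤ X * a := hQ c
    have h2 : b ≤ M := by rw [hM, hb]; exact_mod_cast card_filter_le _ _
    have hb0 : 0 ≤ b := by positivity
    have h3 : b * 2 + (M - b) * 1 ≤ M * Real.exp (b / M) := by
      have := Real.add_one_le_exp (b / M)
      calc _ = M * (b / M + 1) := by field_simp; ring
        _ ≤ _ := mul_le_mul_of_nonneg_left this hM0.le
    calc _ ≤ (M * Real.exp (b / M)) ^ N := pow_le_pow_left₀ (by linarith) h3 N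
      _ = M ^ N * Real.exp (N * (b / M)) := by rw [mul_pow, ← Real.exp_nat_mul]
      _ ≤ _ := by
        gcongr
        calc (N : ℝ) * (b / M) ≤ ((2 * m + 1) * (M / a) + 1) * (b / M) := by gcongr
          _ = (2 * m + 1) * (b / a) + b / M := by field_simp
          _ ≤ _ := by
            gcongr
            · rwa [div_le_iff₀ ha0]
            · rwa [div_le_one hM0]
  -- Since `log 2 ≥ 1/2`, the term `2 * ((2m + 1) X + 1)` of `K` beats the exponential, and `m + 3`
  -- beats the `2 ^ (m + 1)` sets `Q c` with a factor `4` to spare.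
  have hexp2 : Real.exp ((2 * m + 1) * X + 1) * 2 ^ (m + 1) / 2 ^ K ≤ 1 / 4 := by
    have hl : (1 : ℝ) / 2 ≤ Real.log 2 := by have := Real.log_two_gt_d9; linarith
    have hKm : m + 3 ≤ K := by
      have : ((m + 3 : ℕ) : ℝ) ≤ K := by push_cast; nlinarith [mul_nonneg (Nat.cast_nonneg (α := ℝ) m) hX]
      exact_mod_cast this
    obtain ⟨r, rfl⟩ := Nat.exists_eq_add_of_le hKm
    have h1 : Real.exp ((2 * m + 1) * X + 1) ≤ 2 ^ r := by
      rw [← Real.le_log_iff_exp_le (by positivity), Real.log_pow]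
      push_cast at hK
      nlinarith
    rw [div_le_iff₀ (by positivity), pow_add, pow_add, pow_add]
    nlinarith [pow_pos (two_pos (α := ℝ)) m]
  -- Every defect adds at least `1` to `W`: a missed `P i` adds exactly `1`, a `Q c` visited `v`
  -- times adds `2 ^ (v - K)`. As the average of `W` is at most `3/4`, some sequence has no defect.
  let W : (Fin N → α) → ℝ := fun F => ∑ i, ∏ n, (if P i (F n) then (0 : ℝ) else 1) +
    ∑ c, (∏ n, (if Q c (F n) then (2 : ℝ) else 1)) / 2 ^ K
  have hMN : 0 < M ^ N := by positivity
  have hW : ∑ F ∈ Fintype.piFinset (fun _ : Fin N => Ω), W F <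
      ∑ F ∈ Fintype.piFinset (fun _ : Fin N => Ω), (1 : ℝ) := by
    have hone : ∑ F ∈ Fintype.piFinset (fun _ : Fin N => Ω), (1 : ℝ) = M ^ N := by
      simp [hM]
    rw [hone, sum_add_distrib]
    have e1 : ∑ F ∈ Fintype.piFinset (fun _ : Fin N => Ω), ∑ i,
        ∏ n, (if P i (F n) then (0 : ℝ) else 1) ≤ M ^ N * (1 / 2) := by
      rw [sum_comm]
      calc _ ≤ ∑ i : ι, M ^ N * Real.exp (-(2 * m + 1)) := sum_le_sum fun i _ => hmiss i
        _ = Fintype.card ι * (M ^ N * Real.exp (-(2 * m + 1))) := by simp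
        _ ≤ 4 ^ m * (M ^ N * Real.exp (-(2 * m + 1))) := by
          gcongr
          exact_mod_cast hι
        _ = M ^ N * (Real.exp (-(2 * m + 1)) * 4 ^ m) := by ring
        _ ≤ _ := by gcongr
    have e2 : ∑ F ∈ Fintype.piFinset (fun _ : Fin N => Ω), ∑ c,
        (∏ n, (if Q c (F n) then (2 : ℝ) else 1)) / 2 ^ K ≤ M ^ N * (1 / 4) := by
      rw [sum_comm]
      calc _ ≤ ∑ c : κ, M ^ N * Real.exp ((2 * m + 1) * X + 1) / 2 ^ K := by
            refine sum_le_sum fun c _ => ?_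
            rw [← sum_div]
            gcongr
            exact hdeg c
        _ = Fintype.card κ * (M ^ N * Real.exp ((2 * m + 1) * X + 1) / 2 ^ K) := by simp
        _ ≤ 2 ^ (m + 1) * (M ^ N * Real.exp ((2 * m + 1) * X + 1) / 2 ^ K) := by
          gcongr
          exact_mod_cast hκ
        _ = M ^ N * (Real.exp ((2 * m + 1) * X + 1) * 2 ^ (m + 1) / 2 ^ K) := by ring
        _ ≤ _ := by gcongr
    linarith
  obtain ⟨F, hF, hlt⟩ := exists_lt_of_sum_lt hW
  have hn1 : ∀ i, 0 ≤ ∏ n, (if P i (F n) then (0 : ℝ) else 1) := fun i =>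
    prod_nonneg fun n _ => by split_ifs <;> norm_num
  have hn2 : ∀ c, 0 ≤ (∏ n, (if Q c (F n) then (2 : ℝ) else 1)) / 2 ^ K := fun c =>
    div_nonneg (prod_nonneg fun n _ => by split_ifs <;> norm_num) (by positivity)
  refine ⟨N, F, fun n => Fintype.mem_piFinset.mp hF n, fun i => ?_, fun c => ?_⟩
  · by_contra! hno
    have h1 := single_le_sum (fun i _ => hn1 i) (mem_univ i)
    have h2 : 0 ≤ ∑ c, (∏ n, (if Q c (F n) then (2 : ℝ) else 1)) / 2 ^ K :=
      sum_nonneg fun c _ => hn2 c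
    have h3 : ∏ n, (if P i (F n) then (0 : ℝ) else 1) = 1 :=
      prod_eq_one fun n _ => if_neg (hno n)
    simp only [W] at hlt
    linarith
  · have h1 := single_le_sum (fun c _ => hn2 c) (mem_univ c)
    have h2 : 0 ≤ ∑ i, ∏ n, (if P i (F n) then (0 : ℝ) else 1) :=
      sum_nonneg fun i _ => hn1 i
    have h3 : ∏ n, (if Q c (F n) then (2 : ℝ) else 1) = 2 ^ #(univ.filter fun n => Q c (F n)) := by
      rw [prod_ite]; simp
    have h4 : (2 : ℝ) ^ #(univ.filter fun n => Q c (F n)) / 2 ^ K < 1 := by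
      rw [← h3]
      simp only [W] at hlt
      linarith
    rw [div_lt_one (by positivity)] at h4
    exact ((pow_lt_pow_iff_right₀ (by norm_num)).mp h4).le

/-- `S` is `a` together with `k` points outside `a ∪ b`. Taking `a` or `b` empty gives the two
degree counts. -/
lemma card_filter_separating {m : ℕ} (a b : Finset (Fin m)) (hab : Disjoint a b) (k : ℕ) :
    #((powersetCard (#a + k) univ).filter fun S => a ⊆ S ∧ Disjoint b S) =
      (m - #b - #a).choose k := by
  have h := card_filter_powersetCard_subset a (univ \ b) (#a + k)
    (by rw [subset_sdiff]; exact ⟨subset_univ _, hab⟩) (by omega)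
  rw [card_sdiff_of_subset (subset_univ b), card_univ, Fintype.card_fin,
    Nat.add_sub_cancel_left] at h
  rw [← h]
  congr 1
  ext S
  simp only [mem_filter, mem_powersetCard, subset_univ, true_and, subset_sdiff]
  rw [disjoint_comm (a := b)]
  tauto

/-- For sets of sizes `i, j` there is a family of separating sets of small degree. -/
lemma exists_separating_family : ∃ D : ℝ, 0 ≤ D ∧ ∀ m i j K : ℕ,
    2 * ((2 * m + 1) * (D * (m + 1) * 1.1598 ^ m) + 1) + m + 3 ≤ K →
    ∃ (N : ℕ) (S : Fin N → Finset (Fin m)),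
      (∀ a b, #a = i → #b = j → Disjoint a b → ∃ n, a ⊆ S n ∧ Disjoint b (S n)) ∧
      (∀ a, #a = i → #(univ.filter fun n => a ⊆ S n) ≤ K) ∧
      (∀ b, #b = j → #(univ.filter fun n => Disjoint b (S n)) ≤ K) := by
  obtain ⟨D, hD, hbal⟩ := BinomialRatio.exists_balanced_choose
  refine ⟨D, hD, fun m i j K hK => ?_⟩
  rcases lt_or_ge m (i + j) with hlt | hle
  -- No disjoint pair of these sizes fits into `m` points, so the empty family works.
  · refine ⟨0, Fin.elim0, fun a b ha hb hab => ?_, fun a _ => by simp, fun b _ => by simp⟩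
    have := card_le_univ (a ∪ b)
    rw [card_union_of_disjoint hab, Fintype.card_fin] at this
    omega
  obtain ⟨u, rfl⟩ : ∃ u, m = u + i + j := ⟨m - (i + j), by omega⟩
  obtain ⟨k, l, hkl, h1, h2⟩ := hbal u i j
  let ι := {p : Finset (Fin (u + i + j)) × Finset (Fin (u + i + j)) //
    #p.1 = i ∧ #p.2 = j ∧ Disjoint p.1 p.2}
  let κ := {a : Finset (Fin (u + i + j)) // #a = i} ⊕ {b : Finset (Fin (u + i + j)) // #b = j}
  let P : ι → Finset (Fin (u + i + j)) → Prop := fun p S => p.1.1 ⊆ S ∧ Disjoint p.1.2 S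
  let Q : κ → Finset (Fin (u + i + j)) → Prop := fun c S =>
    Sum.elim (fun a => a.1 ⊆ S) (fun b => Disjoint b.1 S) c
  have hbd : D * ((u : ℝ) + 1) * 1.1598 ^ (u + i + j) ≤
      D * (((u + i + j : ℕ) : ℝ) + 1) * 1.1598 ^ (u + i + j) := by
    gcongr
    linarith [(Nat.cast_nonneg i : (0 : ℝ) ≤ i), (Nat.cast_nonneg j : (0 : ℝ) ≤ j)]
  classical
  obtain ⟨N, S, -, hS, hdeg⟩ := exists_sequence (m := u + i + j) (a := u.choose k) (K := K)
    (X := D * ((u + i + j : ℕ) + 1) * 1.1598 ^ (u + i + j))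
    (powersetCard (i + k) (univ : Finset (Fin (u + i + j)))) P Q
    (by rw [card_powersetCard, card_univ, Fintype.card_fin]; exact Nat.choose_pos (by omega))
    (Nat.choose_pos (by omega)) (by positivity)
    (by
      rintro ⟨⟨a, b⟩, ha, hb, hab⟩
      simp only [P] at ha hb hab ⊢
      have hc := card_filter_separating a b hab k
      rw [ha, hb, show u + i + j - j - i = u by omega] at hc
      exact (hc.symm.trans (congrArg card (by ext; simp))).le)
    (by
      rintro (⟨a, ha⟩ | ⟨b, hb⟩)
      · have := card_filter_separating a ∅ (by simp) k
        rw [card_empty, Nat.sub_zero, ha, show u + i + j - i = u + j by omega] at this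
        refine le_of_eq_of_le (congrArg Nat.cast
          (Eq.trans (congrArg card (by ext; rw [mem_filter, mem_filter]; simp [Q])) this)) ?_
        exact h1.trans (mul_le_mul_of_nonneg_right hbd (by positivity))
      · have := card_filter_separating ∅ b (by simp) (i + k)
        rw [card_empty, Nat.sub_zero, zero_add, hb, show u + i + j - j = u + i by omega,
          Nat.choose_symm_of_eq_add (show u + i = i + k + l by omega)] at this
        refine le_of_eq_of_le (congrArg Nat.cast
          (Eq.trans (congrArg card (by ext; rw [mem_filter, mem_filter]; simp [Q])) this)) ?_
        exact h2.trans (mul_le_mul_of_nonneg_right hbd (by positivity)))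
    (by
      refine (Fintype.card_subtype_le _).trans_eq ?_
      rw [Fintype.card_prod, Fintype.card_finset, Fintype.card_fin, ← mul_pow]
      norm_num)
    (by
      rw [Fintype.card_sum, pow_succ, mul_two]
      refine add_le_add ?_ ?_ <;>
      · refine (Fintype.card_subtype_le _).trans_eq ?_
        rw [Fintype.card_finset, Fintype.card_fin])
    hK
  refine ⟨N, S, fun a b ha hb hab => hS ⟨(a, b), ha, hb, hab⟩, fun a ha => ?_, fun b hb => ?_⟩
  · exact le_of_eq_of_le (congrArg card (by ext; rw [mem_filter, mem_filter]; simp [Q])) (hdeg (.inl ⟨a, ha⟩))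
  · exact le_of_eq_of_le (congrArg card (by ext; rw [mem_filter, mem_filter]; simp [Q])) (hdeg (.inr ⟨b, hb⟩))

/-- Families of natural numbers, indexed by sets, that intersect exactly for disjoint sets. -/
lemma exists_node_families : ∃ D : ℝ, 0 ≤ D ∧ ∀ m K : ℕ,
    2 * ((2 * m + 1) * (D * (m + 1) * 1.1598 ^ m) + 1) + m + 3 ≤ K →
    ∃ F G : Finset (Fin m) → Finset ℕ, (∀ a, #(F a) ≤ (m + 1) * K) ∧
      (∀ b, #(G b) ≤ (m + 1) * K) ∧
      ∀ a b, (∃ z, z ∈ F a ∧ z ∈ G b) ↔ Disjoint a b := by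
  obtain ⟨D, hD, h⟩ := exists_separating_family
  refine ⟨D, hD, fun m K hK => ?_⟩
  choose N S hS h1 h2 using fun i j => h m i j K hK
  have hcard : ∀ a : Finset (Fin m), #a < m + 1 := fun a => by
    have := card_le_univ a
    rw [Fintype.card_fin] at this
    omega
  -- A node records both sizes and the index of `S`. The list of `a` has to allow for every size `j`
  -- of the partner, which costs the factor `m + 1`.
  refine ⟨fun a => (range (m + 1)).biUnion fun j => (univ.filter fun n => a ⊆ S #a j n).image
      fun n : Fin (N #a j) => Nat.pair #a (Nat.pair j n),
    fun b => (range (m + 1)).biUnion fun i => (univ.filter fun n => Disjoint b (S i #b n)).image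
      fun n : Fin (N i #b) => Nat.pair i (Nat.pair #b n), fun a => ?_, fun b => ?_, fun a b => ?_⟩
  · refine (card_biUnion_le_card_mul _ _ K fun j _ => ?_).trans_eq (by rw [card_range])
    exact card_image_le.trans (h1 _ _ a rfl)
  · refine (card_biUnion_le_card_mul _ _ K fun j _ => ?_).trans_eq (by rw [card_range])
    exact card_image_le.trans (h2 _ _ b rfl)
  · simp only [mem_biUnion, mem_image, mem_filter, mem_univ, true_and, mem_range]
    constructor
    · rintro ⟨z, ⟨j, -, n, hn, rfl⟩, i, -, n', hn', heq⟩
      rw [Nat.pair_eq_pair, Nat.pair_eq_pair] at heq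
      obtain ⟨rfl, rfl, heq⟩ := heq
      obtain rfl := Fin.ext heq
      exact (hn'.mono_right hn).symm
    · intro hab
      obtain ⟨n, hn, hn'⟩ := hS #a #b a b rfl rfl hab
      exact ⟨_, ⟨#b, hcard b, n, hn, rfl⟩, #a, hcard a, n, hn', rfl⟩

/-- Repeating one element pads every list to the same length `c`, so that positions in a list can
serve as digits in base `c`. -/
lemma exists_enumeration (A : Finset ℕ) (hA : A.Nonempty) {c : ℕ} (hc : #A ≤ c) :
    ∃ h : ℕ → ℕ, (∀ x, h x ∈ A) ∧ ∀ y ∈ A, ∃ x < c, h x = y := by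
  obtain ⟨z, hz⟩ := hA
  refine ⟨fun x => if hx : x < #A then (A.equivFin.symm ⟨x, hx⟩ : ℕ) else z, fun x => ?_,
    fun y hy => ⟨A.equivFin ⟨y, hy⟩, (Fin.is_lt _).trans_le hc, ?_⟩⟩
  · dsimp only
    split_ifs with hx
    · exact Subtype.prop _
    · exact hz
  · simp

/-- The set of positions of the binary digits `1` of `v` among the last `m` digits. -/
def bitSet (m v : ℕ) : Finset (Fin m) := univ.filter fun l => v.testBit l

lemma disjoint_bitSet {m v v' : ℕ} (hv : v < 2 ^ m) :
    Disjoint (bitSet m v) (bitSet m v') ↔ v &&& v' = 0 := by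
  constructor
  · intro h
    refine Nat.eq_of_testBit_eq fun l => ?_
    rw [Nat.testBit_and, Nat.zero_testBit]
    by_contra hne
    simp only [Bool.not_eq_false, Bool.and_eq_true] at hne
    have hl : l < m := by
      by_contra hl
      rw [Nat.testBit_lt_two_pow (hv.trans_le (Nat.pow_le_pow_right (by norm_num) (not_lt.mp hl)))]
        at hne
      simp at hne
    have hd := disjoint_left.mp h
    exact @hd ⟨l, hl⟩ (by simpa [bitSet] using hne.1) (by simpa [bitSet] using hne.2)
  · intro h
    refine disjoint_left.mpr fun l h1 h2 => ?_
    simp only [bitSet, mem_filter, mem_univ, true_and] at h1 h2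
    have := Nat.testBit_and v v' l
    rw [h, h1, h2] at this
    simp at this

/-- A block length `m` and lists of length `2 ^ e ≤ 1.1599 ^ m` such that the lists of two words
of `m` bits have a common entry if and only if the words are disjoint. -/
theorem exists_cover : ∃ (m e s : ℕ) (f g : ℕ → ℕ → ℕ), 0 < m ∧ (2 : ℝ) ^ e ≤ 1.1599 ^ m ∧
    (∀ v x, f v x < 2 ^ s) ∧ (∀ v x, g v x < 2 ^ s) ∧
    ∀ v v', v < 2 ^ m → v' < 2 ^ m →
      ((∃ x < 2 ^ e, ∃ y < 2 ^ e, f v x = g v' y) ↔ v &&& v' = 0) := by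
  obtain ⟨D, hD, h⟩ := exists_node_families
  obtain ⟨m, hm, hgrow⟩ : ∃ m : ℕ, 0 < m ∧
      2 * ((m : ℝ) + 1) * (8 * (D + 1) * (m + 1) ^ 2 * 1.1598 ^ m) ≤ 1.1599 ^ m := by
    -- The polynomial overhead is cubic: `(m + 1) ^ 2` from the degree bound `K` and `m + 1` from
    -- the unknown size of the partner.
    have ht := tendsto_pow_const_div_const_pow_of_one_lt 3
      (show (1 : ℝ) < 1.1599 / 1.1598 by norm_num)
    have hpos : 0 < 1 / (128 * (D + 1)) := by positivity
    obtain ⟨m, hm, hm1⟩ := ((ht.eventually_lt_const hpos).and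
      (Filter.eventually_ge_atTop 1)).exists
    refine ⟨m, hm1, ?_⟩
    have hm1' : (1 : ℝ) ≤ m := by exact_mod_cast hm1
    rw [div_pow, div_div_eq_mul_div, div_lt_div_iff₀ (by positivity) (by positivity), one_mul] at hm
    calc _ = 16 * (D + 1) * ((m : ℝ) + 1) ^ 3 * 1.1598 ^ m := by ring
      _ ≤ 16 * (D + 1) * ((m : ℝ) + m) ^ 3 * 1.1598 ^ m := by gcongr
      _ = (m : ℝ) ^ 3 * 1.1598 ^ m * (128 * (D + 1)) := by ring
      _ ≤ _ := hm.le
  set K := ⌊8 * (D + 1) * ((m : ℝ) + 1) ^ 2 * 1.1598 ^ m⌋₊ with hKdef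
  have hone : (1 : ℝ) ≤ 1.1598 ^ m := one_le_pow₀ (by norm_num)
  have hm1 : (1 : ℝ) ≤ m := by exact_mod_cast hm
  have hK : 2 * ((2 * m + 1) * (D * (m + 1) * 1.1598 ^ m) + 1) + m + 3 ≤ (K : ℝ) := by
    have h1 : 8 * (D + 1) * ((m : ℝ) + 1) ^ 2 * 1.1598 ^ m < K + 1 := Nat.lt_floor_add_one _
    set t : ℝ := 1.1598 ^ m
    have h2 : 0 ≤ D * t := by positivity
    have h3 : 0 ≤ D * t * m := by positivity
    have h4 : 0 ≤ D * t * (m * m) := by positivity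
    have h5 : ((m : ℝ) + 1) ^ 2 * 1 ≤ ((m : ℝ) + 1) ^ 2 * t := by gcongr
    nlinarith
  have hKle : (K : ℝ) ≤ 8 * (D + 1) * ((m : ℝ) + 1) ^ 2 * 1.1598 ^ m :=
    Nat.floor_le (by positivity)
  obtain ⟨F, G, hF, hG, hFG⟩ := h m K hK
  have hKpos : 0 < K := by
    have : (0 : ℝ) < K := by
      refine lt_of_lt_of_le ?_ hK
      positivity
    exact_mod_cast this
  set e := Nat.log 2 ((m + 1) * K) + 1 with he
  have hc : (m + 1) * K ≤ 2 ^ e := (Nat.lt_pow_succ_log_self (by norm_num) _).le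
  have hFne : ∀ a, (F a).Nonempty := fun a => by
    obtain ⟨z, hz, -⟩ := (hFG a ∅).mpr (by simp)
    exact ⟨z, hz⟩
  have hGne : ∀ a, (G a).Nonempty := fun a => by
    obtain ⟨z, -, hz⟩ := (hFG ∅ a).mpr (by simp)
    exact ⟨z, hz⟩
  choose f hf hf' using fun a => exists_enumeration (F a) (hFne a) ((hF a).trans hc)
  choose g hg hg' using fun a => exists_enumeration (G a) (hGne a) ((hG a).trans hc)
  obtain ⟨s, hs⟩ : ∃ s, ∀ a, (∀ z ∈ F a, z < 2 ^ s) ∧ ∀ z ∈ G a, z < 2 ^ s := by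
    refine ⟨∑ a, (∑ z ∈ F a, z + ∑ z ∈ G a, z), fun a => ?_⟩
    have h1 := single_le_sum (f := fun a => ∑ z ∈ F a, z + ∑ z ∈ G a, z) (fun _ _ => Nat.zero_le _)
      (mem_univ a)
    refine ⟨fun z hz => ?_, fun z hz => ?_⟩
    · have h2 := single_le_sum (f := fun z : ℕ => z) (fun _ _ => Nat.zero_le _) hz
      refine lt_of_le_of_lt ?_ Nat.lt_two_pow_self
      omega
    · have h2 := single_le_sum (f := fun z : ℕ => z) (fun _ _ => Nat.zero_le _) hz
      refine lt_of_le_of_lt ?_ Nat.lt_two_pow_self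
      omega
  refine ⟨m, e, s, fun v => f (bitSet m v), fun v => g (bitSet m v), hm, ?_,
    fun v x => (hs _).1 _ (hf _ x), fun v x => (hs _).2 _ (hg _ x), fun v v' hv _ => ?_⟩
  · have h1 : 2 ^ e ≤ 2 * ((m + 1) * K) := by
      rw [he, pow_succ, mul_comm]
      exact Nat.mul_le_mul_left 2 (Nat.pow_log_le_self 2 (by positivity))
    have h2 : (2 : ℝ) ^ e ≤ 2 * ((m + 1) * K) := by exact_mod_cast h1
    calc _ ≤ 2 * (((m : ℝ) + 1) * K) := h2
      _ ≤ 2 * (((m : ℝ) + 1) * (8 * (D + 1) * ((m : ℝ) + 1) ^ 2 * 1.1598 ^ m)) := by gcongr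
      _ = _ := by ring
      _ ≤ _ := hgrow
  · rw [← disjoint_bitSet hv, ← hFG]
    constructor
    · rintro ⟨x, -, y, -, hxy⟩
      exact ⟨_, hf _ x, (show f _ x = g _ y from hxy) ▸ hg _ y⟩
    · rintro ⟨z, hz, hz'⟩
      obtain ⟨x, hx, hx'⟩ := hf' _ z hz
      obtain ⟨y, hy, hy'⟩ := hg' _ z hz'
      exact ⟨x, hx, y, hy, hx'.trans hy'.symm⟩

end DisjointnessCover

/-! ### Deterministic executions -/

namespace WordRAM

lemma run_add (w a b : ℕ) (c : Config) : run w (a + b) c = (run w a c).bind (run w b) := by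
  induction a generalizing c with
  | zero => simp [run, PMF.pure_bind]
  | succ a ih =>
    rw [Nat.succ_add, run, run, PMF.bind_bind]
    congr 1
    funext c'
    exact ih c'

/-- The command `c` runs from `s` without looking at random bits, and within `T` steps it ends in
a state with property `Q`. -/
def Exec (w : ℕ) (c : Cmd) (s : State) (T : ℕ) (Q : State → Prop) : Prop :=
  ∃ t ≤ T, ∃ s', (∀ k, run w t (c :: k, s) = PMF.pure (k, s')) ∧ Q s'

/-- A list of commands as one command. -/
def block : List Cmd → Cmd
  | [] => .skip
  | c :: cs => .seq c (block cs)

namespace Exec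

variable {w : ℕ} {T T' : ℕ} {Q Q' : State → Prop} {R : ℕ → ℕ} {mem : ℕ → ℕ} {cs : List Cmd}

lemma mono {c : Cmd} {s : State} (h : Exec w c s T Q) (hT : T ≤ T') (hQ : ∀ s, Q s → Q' s) :
    Exec w c s T' Q' := by
  obtain ⟨t, ht, s', hr, hq⟩ := h
  exact ⟨t, ht.trans hT, s', hr, hQ _ hq⟩

lemma of_step {c : Cmd} {s s' : State} (h : ∀ k, step w (c :: k, s) = PMF.pure (k, s'))
    (hQ : Q s') : Exec w c s 1 Q :=
  ⟨1, le_rfl, s', fun k => by rw [run, h, PMF.pure_bind, run], hQ⟩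

lemma seq {c₁ c₂ : Cmd} {s : State} (h : Exec w c₁ s T fun s' => Exec w c₂ s' T' Q) :
    Exec w (.seq c₁ c₂) s (T + T' + 1) Q := by
  obtain ⟨t, ht, s', hr, t', ht', s'', hr', hq⟩ := h
  refine ⟨1 + (t + t'), by omega, s'', fun k => ?_, hq⟩
  rw [run_add, run, step, PMF.pure_bind, run, PMF.pure_bind, run_add, hr, PMF.pure_bind, hr']

lemma ite {c₁ c₂ : Cmd} {s : State} {r : ℕ} (h₁ : s.regs r ≠ 0 → Exec w c₁ s T Q)
    (h₂ : s.regs r = 0 → Exec w c₂ s T Q) : Exec w (.ite r c₁ c₂) s (T + 1) Q := by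
  by_cases hr : s.regs r = 0
  · obtain ⟨t, ht, s', h, hq⟩ := h₂ hr
    refine ⟨1 + t, by omega, s', fun k => ?_, hq⟩
    rw [run_add, run, step, if_neg (by simpa using hr), PMF.pure_bind, run, PMF.pure_bind, h]
  · obtain ⟨t, ht, s', h, hq⟩ := h₁ hr
    refine ⟨1 + t, by omega, s', fun k => ?_, hq⟩
    rw [run_add, run, step, if_pos hr, PMF.pure_bind, run, PMF.pure_bind, h]

/-- The index of the invariant `I` is the number of iterations still to come; each costs one test
besides the body, and the final failing test costs one more step. -/
lemma loop {c : Cmd} {r : ℕ} (I : ℕ → State → Prop)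
    (hpos : ∀ n s, I (n + 1) s → s.regs r ≠ 0 ∧ Exec w c s T (I n))
    (hzero : ∀ s, I 0 s → s.regs r = 0) {n : ℕ} {s : State} (hI : I n s) :
    Exec w (.loop r c) s (n * (T + 1) + 1) (I 0) := by
  induction n generalizing s with
  | zero =>
    have h0 : ¬ s.regs r ≠ 0 := by simpa using hzero s hI
    refine (of_step (fun k => ?_) hI).mono (by omega) fun _ h => h
    rw [step, if_neg h0]
  | succ n ih =>
    obtain ⟨hr, t, ht, s', h, hq⟩ := hpos n s hI
    obtain ⟨t', ht', s'', h', hq'⟩ := ih hq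
    refine ⟨1 + (t + t'), by rw [Nat.succ_mul]; omega, s'', fun k => ?_, hq'⟩
    rw [run_add, run, step, if_pos hr, PMF.pure_bind, run, PMF.pure_bind, run_add, h,
      PMF.pure_bind, h']

lemma block_nil {s : State} (hQ : Q s) : Exec w (block []) s (T + 1) Q :=
  (of_step (fun k => by rw [block, step]) hQ).mono (by omega) fun _ h => h

lemma block_cons {c : Cmd} {s : State} (h : Exec w c s T fun s' => Exec w (block cs) s' T' Q) :
    Exec w (block (c :: cs)) s (T + T' + 1) Q := seq h

/-- Rule for symbolic execution: naming the value `v` and showing that it fits into a word removes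
the reduction modulo `2 ^ w`. The two steps are the unfolding of `seq` and the instruction itself.
-/
lemma op_cons {o : Op} {r a b : ℕ} (v : ℕ) (hv : o.eval (R a) (R b) = v) (hlt : v < 2 ^ w)
    (h : Exec w (block cs) ⟨Function.update R r v, mem⟩ T Q) :
    Exec w (block (.op o r a b :: cs)) ⟨R, mem⟩ (T + 2) Q := by
  refine (block_cons (T := 1) (T' := T) (of_step (fun k => by rw [step]) ?_)).mono (by omega) fun _ h => h
  simpa only [State.setReg, hv, Nat.mod_eq_of_lt hlt] using h

lemma const_cons {r v : ℕ} (hlt : v < 2 ^ w)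
    (h : Exec w (block cs) ⟨Function.update R r v, mem⟩ T Q) :
    Exec w (block (.const r v :: cs)) ⟨R, mem⟩ (T + 2) Q := by
  refine (block_cons (T := 1) (T' := T) (of_step (fun k => by rw [step]) ?_)).mono (by omega) fun _ h => h
  simpa only [State.setReg, Nat.mod_eq_of_lt hlt] using h

lemma load_cons {r a : ℕ} (v : ℕ) (hv : mem (R a) = v) (hlt : v < 2 ^ w)
    (h : Exec w (block cs) ⟨Function.update R r v, mem⟩ T Q) :
    Exec w (block (.load r a :: cs)) ⟨R, mem⟩ (T + 2) Q := by
  refine (block_cons (T := 1) (T' := T) (of_step (fun k => by rw [step]) ?_)).mono (by omega) fun _ h => h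
  simpa only [State.setReg, hv, Nat.mod_eq_of_lt hlt] using h

lemma store_cons {a r : ℕ} (x v : ℕ) (hx : R a = x) (hv : R r = v) (hlt : v < 2 ^ w)
    (h : Exec w (block cs) ⟨R, Function.update mem x v⟩ T Q) :
    Exec w (block (.store a r :: cs)) ⟨R, mem⟩ (T + 2) Q := by
  refine (block_cons (T := 1) (T' := T) (of_step (fun k => by rw [step]) ?_)).mono (by omega) fun _ h => h
  simpa only [State.setMem, hx, hv, Nat.mod_eq_of_lt hlt] using h

end Exec

end WordRAM

/-! ### Codes of the nodes that contain a vector -/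

namespace OrthogonalVectors

/-- The number with the digits `tab (X % M) (Y % c)`, where `X` and `Y` are written in base `M` and
in base `c`, appended to `acc` in base `S`. -/
def nodeCode (tab : ℕ → ℕ → ℕ) (M c S : ℕ) : ℕ → ℕ → ℕ → ℕ → ℕ
  | 0, _, _, acc => acc
  | n + 1, X, Y, acc => nodeCode tab M c S n (X / M) (Y / c) (acc * S + tab (X % M) (Y % c))

/-- The accumulator never decreases, so overflow has to be excluded only for the final code. -/
lemma le_nodeCode (tab : ℕ → ℕ → ℕ) {M c S : ℕ} (hS : 0 < S) (n X Y acc : ℕ) :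
    acc ≤ nodeCode tab M c S n X Y acc := by
  induction n generalizing X Y acc with
  | zero => exact le_rfl
  | succ n ih =>
    refine le_trans ?_ (ih _ _ _)
    exact (Nat.le_mul_of_pos_right acc hS).trans (Nat.le_add_right _ _)

lemma nodeCode_lt {tab : ℕ → ℕ → ℕ} {M c S : ℕ} (htab : ∀ v x, tab v x < S) (n k X Y acc : ℕ)
    (hacc : acc < S ^ k) : nodeCode tab M c S n X Y acc < S ^ (k + n) := by
  induction n generalizing k X Y acc with
  | zero => exact hacc
  | succ n ih =>
    rw [nodeCode, show k + (n + 1) = k + 1 + n by omega]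
    refine ih _ _ _ _ ?_
    have := htab (X % M) (Y % c)
    calc acc * S + tab (X % M) (Y % c) < acc * S + S := by omega
      _ = (acc + 1) * S := by ring
      _ ≤ S ^ k * S := Nat.mul_le_mul_right S hacc
      _ = S ^ (k + 1) := by rw [pow_succ]

lemma land_eq_zero_iff_mod_div (m X X' : ℕ) :
    X &&& X' = 0 ↔ X % 2 ^ m &&& X' % 2 ^ m = 0 ∧ X / 2 ^ m &&& X' / 2 ^ m = 0 := by
  rw [← Nat.and_mod_two_pow, ← Nat.and_div_two_pow]
  constructor
  · intro h
    simp [h]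
  · rintro ⟨h1, h2⟩
    rw [← Nat.div_add_mod (X &&& X') (2 ^ m), h1, h2]
    simp

/-- Tensor power of the cover. Entries below `S` are digits, so equal codes agree block by block;
conversely the digits of `t` and `t'` in base `c` choose a list position independently in each
block. General accumulators make the induction peel off one block at a time. -/
theorem exists_nodeCode_eq_iff {f g : ℕ → ℕ → ℕ} {m c S : ℕ} (hf : ∀ v x, f v x < S)
    (hg : ∀ v x, g v x < S) (hc : 0 < c)
    (H : ∀ v v', v < 2 ^ m → v' < 2 ^ m → ((∃ x < c, ∃ y < c, f v x = g v' y) ↔ v &&& v' = 0))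
    (n X X' acc acc' : ℕ) (hX : X < (2 ^ m) ^ n) (hX' : X' < (2 ^ m) ^ n) :
    (∃ t < c ^ n, ∃ t' < c ^ n,
      nodeCode f (2 ^ m) c S n X t acc = nodeCode g (2 ^ m) c S n X' t' acc') ↔
      acc = acc' ∧ X &&& X' = 0 := by
  induction n generalizing X X' acc acc' with
  | zero =>
    obtain rfl : X = 0 := by simpa using hX
    simp [nodeCode]
  | succ n ih =>
    have hM : 0 < 2 ^ m := by positivity
    have hdiv : ∀ {Z : ℕ}, Z < (2 ^ m) ^ (n + 1) → Z / 2 ^ m < (2 ^ m) ^ n := fun hZ => by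
      rw [Nat.div_lt_iff_lt_mul hM, ← pow_succ]; exact hZ
    have ih' := fun a a' => ih (X / 2 ^ m) (X' / 2 ^ m) a a' (hdiv hX) (hdiv hX')
    have H' := H (X % 2 ^ m) (X' % 2 ^ m) (Nat.mod_lt _ hM) (Nat.mod_lt _ hM)
    rw [land_eq_zero_iff_mod_div m X X']
    simp only [nodeCode]
    constructor
    · rintro ⟨t, ht, t', ht', h⟩
      have hq : ∀ {z : ℕ}, z < c ^ (n + 1) → z / c < c ^ n := fun hz => by
        rw [Nat.div_lt_iff_lt_mul hc, ← pow_succ]; exact hz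
      obtain ⟨h1, h2⟩ := (ih' _ _).mp ⟨t / c, hq ht, t' / c, hq ht', h⟩
      have e1 := hf (X % 2 ^ m) (t % c)
      have e2 := hg (X' % 2 ^ m) (t' % c)
      have hS : 0 < S := by omega
      have hmod := congrArg (· % S) h1
      have hdv := congrArg (· / S) h1
      simp only [Nat.mul_add_mod_self_right, Nat.mod_eq_of_lt e1, Nat.mod_eq_of_lt e2] at hmod
      simp only [mul_comm _ S, Nat.mul_add_div hS, Nat.div_eq_of_lt e1, Nat.div_eq_of_lt e2,
        add_zero] at hdv
      exact ⟨hdv, H'.mp ⟨_, Nat.mod_lt _ hc, _, Nat.mod_lt _ hc, hmod⟩, h2⟩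
    · rintro ⟨rfl, h1, h2⟩
      obtain ⟨x, hx, y, hy, hxy⟩ := H'.mpr h1
      obtain ⟨t, ht, t', ht', h⟩ :=
        (ih' (acc * S + f (X % 2 ^ m) x) (acc * S + g (X' % 2 ^ m) y)).mpr ⟨by rw [hxy], h2⟩
      have hlt : ∀ {z x : ℕ}, z < c ^ n → x < c → c * z + x < c ^ (n + 1) := fun {z x} hz hx => by
        calc c * z + x < c * z + c := by omega
          _ = c * (z + 1) := by ring
          _ ≤ c * c ^ n := Nat.mul_le_mul_left c hz
          _ = c ^ (n + 1) := by rw [pow_succ, mul_comm]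
      refine ⟨c * t + x, hlt ht hx, c * t' + y, hlt ht' hy, ?_⟩
      rw [Nat.mul_add_div hc, Nat.mul_add_div hc, Nat.div_eq_of_lt hx, Nat.div_eq_of_lt hy,
        Nat.mul_add_mod, Nat.mul_add_mod, Nat.mod_eq_of_lt hx, Nat.mod_eq_of_lt hy]
      exact h

/-- The number with the `n` binary digits `f p, f (p + 1), …`, appended to `acc`. -/
def packBits (f : ℕ → ℕ) : ℕ → ℕ → ℕ → ℕ
  | 0, _, acc => acc
  | n + 1, p, acc => packBits f n (p + 1) (acc + acc + f p)

lemma le_packBits (f : ℕ → ℕ) (n p acc : ℕ) : acc ≤ packBits f n p acc := by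
  induction n generalizing p acc with
  | zero => exact le_rfl
  | succ n ih => exact le_trans (by omega) (ih (p + 1) (acc + acc + f p))

lemma packBits_lt {f : ℕ → ℕ} (n k p acc : ℕ) (hf : ∀ j < n, f (p + j) ≤ 1)
    (hacc : acc < 2 ^ k) : packBits f n p acc < 2 ^ (k + n) := by
  induction n generalizing k p acc with
  | zero => exact hacc
  | succ n ih =>
    rw [packBits, show k + (n + 1) = k + 1 + n by omega]
    refine ih _ _ _ (fun j hj => ?_) ?_
    · rw [show p + 1 + j = p + (j + 1) by omega]
      exact hf _ (by omega)
    · have : f p ≤ 1 := hf 0 (by omega)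
      rw [pow_succ]
      omega

lemma packBits_land_eq_zero_iff {f : ℕ → ℕ} (n p p' acc acc' : ℕ) (hf : ∀ j < n, f (p + j) ≤ 1)
    (hf' : ∀ j < n, f (p' + j) ≤ 1) :
    packBits f n p acc &&& packBits f n p' acc' = 0 ↔
      acc &&& acc' = 0 ∧ ∀ j < n, ¬ (f (p + j) = 1 ∧ f (p' + j) = 1) := by
  induction n generalizing p p' acc acc' with
  | zero => simp [packBits]
  | succ n ih =>
    have shift : ∀ (z j : ℕ), z + 1 + j = z + (j + 1) := fun z j => by omega
    rw [packBits, packBits, ih _ _ _ _ (fun j hj => by rw [shift]; exact hf _ (by omega))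
      (fun j hj => by rw [shift]; exact hf' _ (by omega)), land_eq_zero_iff_mod_div 1]
    have h0 : f p ≤ 1 := hf 0 (by omega)
    have h0' : f p' ≤ 1 := hf' 0 (by omega)
    have e1 : (acc + acc + f p) % 2 ^ 1 = f p := by omega
    have e2 : (acc + acc + f p) / 2 ^ 1 = acc := by omega
    have e3 : (acc' + acc' + f p') % 2 ^ 1 = f p' := by omega
    have e4 : (acc' + acc' + f p') / 2 ^ 1 = acc' := by omega
    rw [e1, e2, e3, e4]
    have hbit : f p &&& f p' = 0 ↔ ¬ (f p = 1 ∧ f p' = 1) := by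
      generalize f p = x at h0
      generalize f p' = y at h0'
      interval_cases x <;> interval_cases y <;> simp
    rw [hbit]
    constructor
    · rintro ⟨⟨h1, h2⟩, h3⟩
      refine ⟨h2, fun j hj => ?_⟩
      rcases j with _ | j
      · exact h1
      · have := h3 j (by omega)
        rwa [shift, shift] at this
    · rintro ⟨h1, h2⟩
      refine ⟨⟨h2 0 (by omega), h1⟩, fun j hj => ?_⟩
      rw [shift, shift]
      exact h2 (j + 1) (by omega)

/-- Finitely many words can be read off one large number. -/
lemma exists_table (s K : ℕ) (h : ℕ → ℕ) (hh : ∀ i, h i < 2 ^ s) :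
    ∃ T : ℕ, ∀ i < K, (T >>> (s * i)) % 2 ^ s = h i := by
  induction K generalizing h with
  | zero => exact ⟨0, fun i hi => absurd hi (by omega)⟩
  | succ K ih =>
    obtain ⟨T, hT⟩ := ih (fun i => h (i + 1)) fun i => hh _
    refine ⟨2 ^ s * T + h 0, fun i hi => ?_⟩
    rcases i with _ | i
    · simp [Nat.mod_eq_of_lt (hh 0)]
    · rw [show s * (i + 1) = s + s * i by ring, Nat.shiftRight_add, Nat.shiftRight_eq_div_pow _ s,
        Nat.mul_add_div (by positivity), Nat.div_eq_of_lt (hh 0), add_zero]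
      exact hT i (by omega)

/-! ### Rows of the input as words -/

section Input

variable {n d : ℕ} (A B : Fin n → Finset (Fin d))

lemma inputMem_le_one {x : ℕ} (hx : 2 ≤ x) : inputMem A B x ≤ 1 := by
  rw [inputMem, if_neg (by omega), if_neg (by omega)]
  split_ifs <;> omega

lemma inputMem_left (i : Fin n) (j : Fin d) : inputMem A B (2 + i * d + j) = 1 ↔ j ∈ A i := by
  have hi := i.2
  have hj := j.2
  rw [inputMem, if_neg (by omega), if_neg (by omega)]
  have hlt : (i : ℕ) * d + j < n * d := by
    calc (i : ℕ) * d + j < i * d + d := by omega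
      _ = (i + 1) * d := by ring
      _ ≤ n * d := Nat.mul_le_mul_right d hi
  constructor
  · intro h
    split_ifs at h with h'
    rcases h' with ⟨i', j', he, hm⟩ | ⟨i', j', he, hm⟩
    · have hj' := j'.2
      have e1 : (i : ℕ) * d + j = i' * d + j' := by omega
      have e2 := congrArg (· / d) e1
      have e3 := congrArg (· % d) e1
      have hd : 0 < d := by omega
      simp only [mul_comm _ d, Nat.mul_add_div hd, Nat.mul_add_mod, Nat.div_eq_of_lt hj,
        Nat.div_eq_of_lt hj', Nat.mod_eq_of_lt hj, Nat.mod_eq_of_lt hj', add_zero] at e2 e3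
      rwa [Fin.ext e2, Fin.ext e3]
    · exfalso
      have := Nat.zero_le ((i' : ℕ) * d)
      omega
  · intro h
    rw [if_pos (Or.inl ⟨i, j, rfl, h⟩)]

lemma inputMem_right (i : Fin n) (j : Fin d) :
    inputMem A B (2 + (n + i) * d + j) = 1 ↔ j ∈ B i := by
  have hi := i.2
  have hj := j.2
  rw [inputMem, if_neg (by omega), if_neg (by omega)]
  have e0 : (n + (i : ℕ)) * d = n * d + i * d := by ring
  rw [e0]
  constructor
  · intro h
    split_ifs at h with h'
    rcases h' with ⟨i', j', he, hm⟩ | ⟨i', j', he, hm⟩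
    · exfalso
      have hlt : (i' : ℕ) * d + j' < n * d := by
        calc (i' : ℕ) * d + j' < i' * d + d := by omega
          _ = (i' + 1) * d := by ring
          _ ≤ n * d := Nat.mul_le_mul_right d i'.2
      have := Nat.zero_le ((i : ℕ) * d)
      omega
    · have hj' := j'.2
      have e1 : (i : ℕ) * d + j = i' * d + j' := by omega
      have e2 := congrArg (· / d) e1
      have e3 := congrArg (· % d) e1
      have hd : 0 < d := by omega
      simp only [mul_comm _ d, Nat.mul_add_div hd, Nat.mul_add_mod, Nat.div_eq_of_lt hj,
        Nat.div_eq_of_lt hj', Nat.mod_eq_of_lt hj, Nat.mod_eq_of_lt hj', add_zero] at e2 e3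
      rwa [Fin.ext e2, Fin.ext e3]
  · intro h
    rw [if_pos (Or.inr ⟨i, j, by ring, h⟩)]

lemma inputMem_eq_zero {x : ℕ} (hx : 2 + 2 * (n * d) ≤ x) : inputMem A B x = 0 := by
  have hlt : ∀ (i : Fin n) (j : Fin d), (i : ℕ) * d + j < n * d := fun i j => by
    calc (i : ℕ) * d + j < i * d + d := by omega
      _ = (i + 1) * d := by ring
      _ ≤ n * d := Nat.mul_le_mul_right d i.2
  rw [inputMem, if_neg (by omega), if_neg (by omega), if_neg]
  rintro (⟨i, j, he, -⟩ | ⟨i, j, he, -⟩) <;>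
  · have := hlt i j
    omega

/-- The vector in row `r` of the input, as a word. -/
noncomputable def row (r : ℕ) : ℕ := packBits (inputMem A B) d (2 + r * d) 0

lemma row_lt (r : ℕ) : row A B r < 2 ^ d := by
  have := packBits_lt (f := inputMem A B) d 0 (2 + r * d) 0
    (fun j _ => inputMem_le_one A B (by omega)) (by norm_num)
  rwa [zero_add] at this

lemma row_land_row_eq_zero_iff (i i' : Fin n) :
    row A B i &&& row A B (n + i') = 0 ↔ Disjoint (A i) (B i') := by
  rw [row, row, packBits_land_eq_zero_iff _ _ _ _ _
    (fun j _ => inputMem_le_one A B (by omega)) (fun j _ => inputMem_le_one A B (by omega)),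
    Finset.disjoint_left]
  constructor
  · rintro ⟨-, h⟩ j hj hj'
    exact h j j.2 ⟨(inputMem_left A B i j).mpr hj, (inputMem_right A B i' j).mpr hj'⟩
  · refine fun h => ⟨rfl, fun j hj h' => ?_⟩
    exact h ((inputMem_left A B i ⟨j, hj⟩).mp h'.1) ((inputMem_right A B i' ⟨j, hj⟩).mp h'.2)

end Input

end OrthogonalVectors

/-! ### The program -/

namespace OrthogonalVectors

open WordRAM

/-- The constants of the program: the block length `m`, lists of length `2 ^ e`, nodes of `s` bits,
and the number `T` that holds the lists. -/
structure Params where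
  (m e s T : ℕ)

namespace Params

variable (P : Params)

/-- The list entries, as read off `T`; the lists of the two sides start at offsets `0` and
`2 ^ m`. -/
def tab (off v x : ℕ) : ℕ := (P.T >>> (P.s * ((off + v) * 2 ^ P.e + x))) % 2 ^ P.s

/-- The number of blocks. -/
def blocks (d : ℕ) : ℕ := d / P.m + 1

/-- The number of codes of a vector. -/
def count (d : ℕ) : ℕ := 2 ^ (P.e * P.blocks d)

/-- The `t`-th code of the vector `V`. -/
def code (d off V t : ℕ) : ℕ :=
  nodeCode (P.tab off) (2 ^ P.m) (2 ^ P.e) (2 ^ P.s) (P.blocks d) V t 0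

/-- The first memory cell after the input. -/
def base (n d : ℕ) : ℕ := n * d + n * d + 1 + 1

/-- Words of `w` bits hold all numbers that occur. -/
structure Fits (w n d : ℕ) : Prop where
  index : (2 ^ P.m + 2 ^ P.m) * 2 ^ P.e * (P.s + 1) < 2 ^ w
  table : P.T < 2 ^ w
  space : base n d + (2 ^ P.s) ^ P.blocks d < 2 ^ w
  count : P.count d < 2 ^ w
  blocks : P.blocks d < 2 ^ w
  shift : P.e * P.blocks d < 2 ^ w
  vector : 2 ^ d < 2 ^ w
  rows : n + n < 2 ^ w
  length : P.m < 2 ^ w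
  bits : 2 ^ P.s < 2 ^ w

/-- The registers that keep their values. -/
structure Consts (n d : ℕ) (R : ℕ → ℕ) : Prop where
  r1 : R 1 = 1
  r2 : R 2 = 2 ^ P.m
  r3 : R 3 = 2 ^ P.e
  r4 : R 4 = P.s
  r5 : R 5 = 2 ^ P.s
  r6 : R 6 = P.T
  r7 : R 7 = base n d
  r8 : R 8 = P.count d
  r9 : R 9 = P.blocks d
  r10 : R 10 = n
  r11 : R 11 = d

/-- Append the digit for one block to the code in register `22`. -/
def digitStep : List Cmd :=
  [.op .mod 24 20 2, .op .add 24 24 17, .op .mul 24 24 3, .op .mod 25 21 3, .op .add 24 24 25,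
    .op .mul 24 24 4, .op .shr 24 6 24, .op .mod 24 24 5, .op .mul 22 22 5, .op .add 22 22 24,
    .op .div 20 20 2, .op .div 21 21 3, .op .sub 23 23 1]

/-- Append the next input bit to the vector in register `16`. -/
def packStep : List Cmd :=
  [.load 19 14, .op .add 16 16 16, .op .add 16 16 19, .op .add 14 14 1, .op .sub 18 18 1]

/-- Mark the cell of one code of the vector in register `16`, or look whether it is marked. -/
def codeStep : List Cmd :=
  -- `or` of a register with itself serves as a move.
  [.op .sub 18 18 1, .op .or 20 16 16, .op .or 21 18 18, .const 22 0, .op .or 23 9 9,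
    .loop 23 (block digitStep), .op .add 22 22 7,
    .ite 15 (block [.store 22 1]) (block [.load 24 22, .op .or 0 0 24])]

/-- Handle one row of the input. -/
def rowStep : List Cmd :=
  [.op .lt 15 10 13, .ite 15 (block [.const 17 0]) (block [.op .or 17 2 2]), .const 16 0,
    .op .or 18 11 11, .loop 18 (block packStep), .op .or 18 8 8, .loop 18 (block codeStep),
    .op .sub 13 13 1]

/-- The algorithm. -/
def program : Cmd :=
  block [.const 1 1, .const 2 (2 ^ P.m), .const 3 (2 ^ P.e), .const 4 P.s, .const 5 (2 ^ P.s),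
    -- Registers `24` and `1` hold the addresses `0` and `1`, where `n` and `d` are stored.
    .const 6 P.T, .const 24 0, .load 10 24, .load 11 1, .op .mul 7 10 11, .op .add 7 7 7,
    .op .add 7 7 1, .op .add 7 7 1, .const 24 P.m, .op .div 9 11 24, .op .add 9 9 1,
    .const 24 P.e, .op .mul 24 24 9, .op .shl 8 1 24, .op .add 13 10 10, .const 14 2,
    .loop 13 (block rowStep)]

/-! ### Execution of the loops for one row -/

variable {P} {w n d : ℕ} {R mem : ℕ → ℕ}

lemma Consts.congr {R' : ℕ → ℕ} (h : P.Consts n d R) (hR : ∀ r < 13, r ≠ 0 → R' r = R r) :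
    P.Consts n d R' := by
  constructor <;> rw [hR _ (by norm_num) (by norm_num)]
  exacts [h.r1, h.r2, h.r3, h.r4, h.r5, h.r6, h.r7, h.r8, h.r9, h.r10, h.r11]

lemma tab_lt (off v x : ℕ) : P.tab off v x < 2 ^ P.s := Nat.mod_lt _ (by positivity)

lemma code_lt (off V t : ℕ) : P.code d off V t < (2 ^ P.s) ^ P.blocks d := by
  have := nodeCode_lt (M := 2 ^ P.m) (c := 2 ^ P.e) (tab_lt (P := P) off) (P.blocks d) 0 V t 0
    (by norm_num)
  rwa [zero_add] at this

lemma exec_digits (hw : P.Fits w n d) (hR : P.Consts n d R) {off q X Y acc : ℕ}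
    (h17 : R 17 = off) (hoff : off ≤ 2 ^ P.m) (h20 : R 20 = X) (h21 : R 21 = Y) (h22 : R 22 = acc)
    (h23 : R 23 = q) (hX : X < 2 ^ w) (hY : Y < 2 ^ w) (hq : q < 2 ^ w)
    (ht : nodeCode (P.tab off) (2 ^ P.m) (2 ^ P.e) (2 ^ P.s) q X Y acc < 2 ^ w) :
    Exec w (.loop 23 (block digitStep)) ⟨R, mem⟩ (q * 28 + 1) fun s' => s'.mem = mem ∧
      (∀ r < 20, s'.regs r = R r) ∧
      s'.regs 22 = nodeCode (P.tab off) (2 ^ P.m) (2 ^ P.e) (2 ^ P.s) q X Y acc := by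
  set target := nodeCode (P.tab off) (2 ^ P.m) (2 ^ P.e) (2 ^ P.s) q X Y acc with htarget
  -- Invariant: finishing the remaining `k` blocks from the current registers still produces
  -- `target`. The body takes `27` steps, two for each of its `13` instructions and one for the
  -- closing `skip`.
  refine (Exec.loop (T := 27) (fun k s' => s'.mem = mem ∧ (∀ r < 20, s'.regs r = R r) ∧
    s'.regs 23 = k ∧ k < 2 ^ w ∧ s'.regs 20 < 2 ^ w ∧ s'.regs 21 < 2 ^ w ∧
    nodeCode (P.tab off) (2 ^ P.m) (2 ^ P.e) (2 ^ P.s) k (s'.regs 20) (s'.regs 21) (s'.regs 22)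
      = target) ?_ (fun s' h => h.2.2.1) (n := q) ?_).mono le_rfl ?_
  · rintro k ⟨R', mem'⟩ ⟨hm, hfr, h23, hk, hX, hY, hcode⟩
    simp only at hm hfr h23 hX hY hcode
    subst hm
    refine ⟨by simp [h23], ?_⟩
    have c1 : R' 1 = 1 := (hfr 1 (by norm_num)).trans hR.r1
    have c2 : R' 2 = 2 ^ P.m := (hfr 2 (by norm_num)).trans hR.r2
    have c3 : R' 3 = 2 ^ P.e := (hfr 3 (by norm_num)).trans hR.r3
    have c4 : R' 4 = P.s := (hfr 4 (by norm_num)).trans hR.r4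
    have c5 : R' 5 = 2 ^ P.s := (hfr 5 (by norm_num)).trans hR.r5
    have c6 : R' 6 = P.T := (hfr 6 (by norm_num)).trans hR.r6
    have c17 : R' 17 = off := (hfr 17 (by norm_num)).trans h17
    rw [nodeCode] at hcode
    generalize hX' : R' 20 = X' at hX hcode
    generalize hY' : R' 21 = Y' at hY hcode
    generalize hA' : R' 22 = A' at hcode
    have hv : X' % 2 ^ P.m < 2 ^ P.m := Nat.mod_lt _ (by positivity)
    have hx : Y' % 2 ^ P.e < 2 ^ P.e := Nat.mod_lt _ (by positivity)
    have hpe : 0 < 2 ^ P.e := by positivity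
    have b1 : (off + X' % 2 ^ P.m) * 2 ^ P.e + Y' % 2 ^ P.e < (2 ^ P.m + 2 ^ P.m) * 2 ^ P.e := by
      calc _ < (off + X' % 2 ^ P.m) * 2 ^ P.e + 2 ^ P.e := by omega
        _ = (off + X' % 2 ^ P.m + 1) * 2 ^ P.e := by ring
        _ ≤ _ := Nat.mul_le_mul_right _ (by omega)
    have b2 : (2 ^ P.m + 2 ^ P.m) * 2 ^ P.e ≤ (2 ^ P.m + 2 ^ P.m) * 2 ^ P.e * (P.s + 1) :=
      Nat.le_mul_of_pos_right _ (by omega)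
    have b3 : ((off + X' % 2 ^ P.m) * 2 ^ P.e + Y' % 2 ^ P.e) * P.s ≤
        (2 ^ P.m + 2 ^ P.m) * 2 ^ P.e * (P.s + 1) := Nat.mul_le_mul b1.le (by omega)
    have b4 : off + X' % 2 ^ P.m ≤ (off + X' % 2 ^ P.m) * 2 ^ P.e := Nat.le_mul_of_pos_right _ hpe
    have b5 : P.tab off (X' % 2 ^ P.m) (Y' % 2 ^ P.e) ≤ P.T :=
      (Nat.mod_le _ _).trans (by rw [Nat.shiftRight_eq_div_pow]; exact Nat.div_le_self _ _)
    have b6 := le_nodeCode (P.tab off) (M := 2 ^ P.m) (c := 2 ^ P.e)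
      (show 0 < 2 ^ P.s by positivity) k (X' / 2 ^ P.m) (Y' / 2 ^ P.e)
      (A' * 2 ^ P.s + P.tab off (X' % 2 ^ P.m) (Y' % 2 ^ P.e))
    rw [hcode] at b6
    have hi := hw.index
    have hT := hw.table
    unfold digitStep
    refine Exec.op_cons (X' % 2 ^ P.m) (by simp [Op.eval, hX', c2]) (by omega) ?_
    refine Exec.op_cons (off + X' % 2 ^ P.m) (by simp [Op.eval, c17, add_comm]) (by omega) ?_
    refine Exec.op_cons ((off + X' % 2 ^ P.m) * 2 ^ P.e) (by simp [Op.eval, c3]) (by omega) ?_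
    refine Exec.op_cons (Y' % 2 ^ P.e) (by simp [Op.eval, c3, hY']) (by omega) ?_
    refine Exec.op_cons ((off + X' % 2 ^ P.m) * 2 ^ P.e + Y' % 2 ^ P.e) (by simp [Op.eval])
      (by omega) ?_
    refine Exec.op_cons (((off + X' % 2 ^ P.m) * 2 ^ P.e + Y' % 2 ^ P.e) * P.s)
      (by simp [Op.eval, c4]) (by omega) ?_
    refine Exec.op_cons (P.T >>> (P.s * ((off + X' % 2 ^ P.m) * 2 ^ P.e + Y' % 2 ^ P.e)))
      (by simp [Op.eval, c6, mul_comm])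
      (by rw [Nat.shiftRight_eq_div_pow]; exact (Nat.div_le_self _ _).trans_lt hT) ?_
    refine Exec.op_cons (P.tab off (X' % 2 ^ P.m) (Y' % 2 ^ P.e)) (by simp [Op.eval, c5, tab])
      (by omega) ?_
    refine Exec.op_cons (A' * 2 ^ P.s) (by simp [Op.eval, c5, hA']) (by omega) ?_
    refine Exec.op_cons (A' * 2 ^ P.s + P.tab off (X' % 2 ^ P.m) (Y' % 2 ^ P.e))
      (by simp [Op.eval]) (by omega) ?_
    refine Exec.op_cons (X' / 2 ^ P.m) (by simp [Op.eval, hX', c2])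
      ((Nat.div_le_self _ _).trans_lt hX) ?_
    refine Exec.op_cons (Y' / 2 ^ P.e) (by simp [Op.eval, hY', c3])
      ((Nat.div_le_self _ _).trans_lt hY) ?_
    refine Exec.op_cons k (by simp [Op.eval, h23, c1]) (by omega) ?_
    refine Exec.block_nil (T := 0) ⟨rfl, fun r hr => ?_, by simp, by omega, ?_, ?_, ?_⟩
    · simp (disch := omega) only [Function.update_of_ne]
      exact hfr r hr
    · simpa using (Nat.div_le_self _ _).trans_lt hX
    · simpa using (Nat.div_le_self _ _).trans_lt hY
    · simpa using hcode
  · exact ⟨rfl, fun _ _ => rfl, h23, hq, by simpa [h20] using hX, by simpa [h21] using hY,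
      by simp [h20, h21, h22, htarget]⟩
  · rintro s' ⟨hm, hfr, -, -, -, -, h⟩
    exact ⟨hm, hfr, h⟩

lemma exec_pack (hR : P.Consts n d R) {p acc k : ℕ} (h14 : R 14 = p)
    (h16 : R 16 = acc) (h18 : R 18 = k) (hk : k < 2 ^ w) (hp : p + k < 2 ^ w)
    (ht : packBits mem k p acc < 2 ^ w) :
    Exec w (.loop 18 (block packStep)) ⟨R, mem⟩ (k * 12 + 1) fun s' => s'.mem = mem ∧
      (∀ r < 18, r ≠ 14 → r ≠ 16 → s'.regs r = R r) ∧ s'.regs 14 = p + k ∧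
      s'.regs 16 = packBits mem k p acc := by
  refine (Exec.loop (T := 11) (fun j s' => s'.mem = mem ∧
    (∀ r < 18, r ≠ 14 → r ≠ 16 → s'.regs r = R r) ∧ s'.regs 18 = j ∧ j < 2 ^ w ∧
    s'.regs 14 + j = p + k ∧ packBits mem j (s'.regs 14) (s'.regs 16) = packBits mem k p acc)
    ?_ (fun s' h => h.2.2.1) (n := k) ?_).mono le_rfl ?_
  · rintro j ⟨R', mem'⟩ ⟨hm, hfr, h18, hj, h14, hpack⟩
    simp only at hm hfr h18 h14 hpack
    subst hm
    refine ⟨by simp [h18], ?_⟩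
    have c1 : R' 1 = 1 := (hfr 1 (by norm_num) (by norm_num) (by norm_num)).trans hR.r1
    rw [packBits] at hpack
    generalize hX' : R' 14 = X' at h14 hpack
    generalize hA' : R' 16 = A' at hpack
    have b := le_packBits mem' j (X' + 1) (A' + A' + mem' X')
    rw [hpack] at b
    unfold packStep
    refine Exec.load_cons (mem' X') (by rw [hX']) (by omega) ?_
    refine Exec.op_cons (A' + A') (by simp [Op.eval, hA']) (by omega) ?_
    refine Exec.op_cons (A' + A' + mem' X') (by simp [Op.eval]) (by omega) ?_
    refine Exec.op_cons (X' + 1) (by simp [Op.eval, hX', c1]) (by omega) ?_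
    refine Exec.op_cons j (by simp [Op.eval, h18, c1]) (by omega) ?_
    refine Exec.block_nil (T := 0) ⟨rfl, fun r hr h14 h16 => ?_, by simp, by omega, ?_, ?_⟩
    · simp (disch := omega) only [Function.update_of_ne]
      exact hfr r hr h14 h16
    · simp; omega
    · simpa using hpack
  · exact ⟨rfl, fun _ _ _ _ => rfl, h18, hk, by simp [h14], by simp [h14, h16]⟩
  · rintro s' ⟨hm, hfr, -, -, h14, h⟩
    exact ⟨hm, hfr, h14, h⟩

/-- Register `15` selects marking (rows of `A`) or lookup (rows of `B`). Keeping the answer and the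
marks below `2` keeps their `or` below `2`. -/
lemma exec_codeStep (hw : P.Fits w n d) (hR : P.Consts n d R) {off V k : ℕ} (h17 : R 17 = off)
    (hoff : off ≤ 2 ^ P.m) (h16 : R 16 = V) (hV : V < 2 ^ w) (h18 : R 18 = k + 1)
    (hk : k < 2 ^ w) (h0 : R 0 < 2) (hmem : ∀ x, mem (base n d + x) < 2) :
    Exec w (block codeStep) ⟨R, mem⟩ (P.blocks d * 28 + 22) fun s' =>
      (∀ r < 18, r ≠ 0 → s'.regs r = R r) ∧ s'.regs 18 = k ∧
      (R 15 ≠ 0 → s'.mem = Function.update mem (base n d + P.code d off V k) 1 ∧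
        s'.regs 0 = R 0) ∧
      (R 15 = 0 → s'.mem = mem ∧ s'.regs 0 = R 0 ||| mem (base n d + P.code d off V k)) := by
  have hs := hw.space
  have hcode := code_lt (P := P) (d := d) off V k
  have hpos : 0 < (2 ^ P.s) ^ P.blocks d := by positivity
  have hbase : 2 ≤ base n d := by unfold base; omega
  unfold codeStep
  refine (Exec.op_cons (T := P.blocks d * 28 + 20) k (by simp [Op.eval, h18, hR.r1]) hk ?_)
  refine (Exec.op_cons (T := P.blocks d * 28 + 18) V (by simp [Op.eval, h16]) hV ?_)
  refine (Exec.op_cons (T := P.blocks d * 28 + 16) k (by simp [Op.eval]) hk ?_)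
  refine (Exec.const_cons (T := P.blocks d * 28 + 14) (by positivity) ?_)
  refine (Exec.op_cons (T := P.blocks d * 28 + 12) (P.blocks d) (by simp [Op.eval, hR.r9])
    hw.blocks ?_)
  refine (Exec.block_cons (T := P.blocks d * 28 + 1) (T' := 10) ?_).mono (by omega) fun _ h => h
  refine (exec_digits (off := off) (X := V) (Y := k) (acc := 0) (q := P.blocks d) hw
    (hR.congr fun r hr _ => ?_) (by simpa using h17) hoff (by simp) (by simp) (by simp) (by simp)
    hV hk hw.blocks (lt_trans hcode (by omega))).mono le_rfl ?_
  · simp (disch := omega) only [Function.update_of_ne]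
  rintro ⟨R', mem'⟩ ⟨hm, hfr, h22⟩
  simp only at hm hfr h22
  subst hm
  change R' 22 = P.code d off V k at h22
  have hfr' : ∀ r < 18, R' r = R r := fun r hr => by
    rw [hfr r (by omega)]
    simp (disch := omega) only [Function.update_of_ne]
  have h18' : R' 18 = k := by rw [hfr 18 (by norm_num)]; simp
  refine Exec.op_cons (base n d + P.code d off V k)
    (by simp [Op.eval, h22, hfr' 7 (by norm_num), hR.r7, add_comm]) (by omega) ?_
  refine Exec.block_cons (T := 6) (T' := 1) ?_
  refine Exec.ite (T := 5) (fun h15 => ?_) fun h15 => ?_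
  · refine Exec.store_cons (base n d + P.code d off V k) 1 (by simp)
      (by simp [hfr' 1 (by norm_num), hR.r1]) (by omega) ?_
    refine Exec.block_nil (Exec.block_nil (T := 0) ?_)
    have h15' : R 15 ≠ 0 := by
      rw [← hfr' 15 (by norm_num)]
      simpa using h15
    refine ⟨fun r hr hr0 => ?_, by simpa using h18', fun _ => ⟨rfl, ?_⟩, fun h => absurd h h15'⟩
    · simp (disch := omega) only [Function.update_of_ne]
      exact hfr' r hr
    · simpa using hfr' 0 (by norm_num)
  · have hor : R 0 ||| mem' (base n d + P.code d off V k) < 2 ^ 1 :=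
      Nat.or_lt_two_pow (by simpa using h0) (by simpa using hmem (P.code d off V k))
    refine Exec.load_cons (mem' (base n d + P.code d off V k)) (by simp)
      ((hmem _).trans (by omega)) ?_
    refine Exec.op_cons (R 0 ||| mem' (base n d + P.code d off V k))
      (by simp [Op.eval, hfr' 0 (by norm_num)]) (by omega) ?_
    refine Exec.block_nil (Exec.block_nil (T := 0) ?_)
    have h15' : R 15 = 0 := by
      rw [← hfr' 15 (by norm_num)]
      simpa using h15
    refine ⟨fun r hr hr0 => ?_, by simpa using h18', fun h => absurd h15' h, fun _ => ⟨rfl, ?_⟩⟩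
    · simp (disch := omega) only [Function.update_of_ne]
      exact hfr' r hr
    · simp

lemma exec_codes (hw : P.Fits w n d) (hR : P.Consts n d R) {off V : ℕ} (h17 : R 17 = off)
    (hoff : off ≤ 2 ^ P.m) (h16 : R 16 = V) (hV : V < 2 ^ w) (h18 : R 18 = P.count d)
    (h0 : R 0 < 2) (hmem : ∀ x, mem (base n d + x) < 2) :
    Exec w (.loop 18 (block codeStep)) ⟨R, mem⟩ (P.count d * (P.blocks d * 28 + 23) + 1) fun s' =>
      (∀ r < 18, r ≠ 0 → s'.regs r = R r) ∧ (∀ x < base n d, s'.mem x = mem x) ∧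
      s'.regs 0 < 2 ∧ (∀ x, s'.mem (base n d + x) < 2) ∧
      (R 15 ≠ 0 → s'.regs 0 = R 0 ∧ ∀ x, s'.mem (base n d + x) ≠ 0 ↔
        mem (base n d + x) ≠ 0 ∨ ∃ t < P.count d, P.code d off V t = x) ∧
      (R 15 = 0 → s'.mem = mem ∧ (s'.regs 0 ≠ 0 ↔
        R 0 ≠ 0 ∨ ∃ t < P.count d, mem (base n d + P.code d off V t) ≠ 0)) := by
  refine (Exec.loop (T := P.blocks d * 28 + 22) (fun j s' =>
      (∀ r < 18, r ≠ 0 → s'.regs r = R r) ∧ s'.regs 18 = j ∧ j ≤ P.count d ∧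
      (∀ x < base n d, s'.mem x = mem x) ∧ s'.regs 0 < 2 ∧ (∀ x, s'.mem (base n d + x) < 2) ∧
      (R 15 ≠ 0 → s'.regs 0 = R 0 ∧ ∀ x, s'.mem (base n d + x) ≠ 0 ↔
        mem (base n d + x) ≠ 0 ∨ ∃ t, j ≤ t ∧ t < P.count d ∧ P.code d off V t = x) ∧
      (R 15 = 0 → s'.mem = mem ∧ (s'.regs 0 ≠ 0 ↔
        R 0 ≠ 0 ∨ ∃ t, j ≤ t ∧ t < P.count d ∧ mem (base n d + P.code d off V t) ≠ 0)))
    ?_ (fun s' h => h.2.1) (n := P.count d) ?_).mono le_rfl ?_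
  · rintro j ⟨R', mem'⟩ ⟨hfr, h18, hj, hlow, h0, hmem, hA, hB⟩
    simp only at hfr h18 hlow h0 hmem hA hB
    refine ⟨by simp [h18], ?_⟩
    have hc := hw.count
    -- The counter is decremented before use, so codes are handled downwards and this iteration adds
    -- the index `j`.
    have hsplit : ∀ (p : ℕ → Prop), (∃ t, j ≤ t ∧ t < P.count d ∧ p t) ↔
        (p j ∨ ∃ t, j + 1 ≤ t ∧ t < P.count d ∧ p t) := by
      intro p
      constructor
      · rintro ⟨t, ht, ht', hp⟩
        rcases eq_or_lt_of_le ht with rfl | h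
        · exact Or.inl hp
        · exact Or.inr ⟨t, h, ht', hp⟩
      · rintro (hp | ⟨t, ht, ht', hp⟩)
        · exact ⟨j, le_rfl, by omega, hp⟩
        · exact ⟨t, by omega, ht', hp⟩
    refine (exec_codeStep (off := off) (V := V) (k := j) hw
      (hR.congr fun r hr h => hfr r (by omega) h)
      ((hfr 17 (by norm_num) (by norm_num)).trans h17) hoff
      ((hfr 16 (by norm_num) (by norm_num)).trans h16) hV h18 (by omega) h0 hmem).mono le_rfl ?_
    rintro ⟨R'', mem''⟩ ⟨hfr', h18', hA', hB'⟩
    simp only at hfr' h18' hA' hB'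
    rw [hfr 15 (by norm_num) (by norm_num)] at hA' hB'
    refine ⟨fun r hr h => (hfr' r hr h).trans (hfr r hr h), h18', by omega, ?_⟩
    simp only
    by_cases h15 : R 15 = 0
    · obtain ⟨rfl, hreg⟩ := hB' h15
      obtain ⟨rfl, hB⟩ := hB h15
      refine ⟨fun _ _ => rfl, ?_, hmem, fun h => absurd h15 h, fun _ => ⟨rfl, ?_⟩⟩
      · rw [hreg]
        exact Nat.or_lt_two_pow (n := 1) (by simpa using h0) (by simpa using hmem _)
      · have hB' : ¬ R' 0 = 0 ↔ _ := hB
        rw [hsplit, hreg, Ne, Nat.or_eq_zero_iff, not_and_or, hB', or_assoc]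
        exact or_congr_right or_comm
    · obtain ⟨rfl, hreg⟩ := hA' h15
      obtain ⟨hreg', hA⟩ := hA h15
      refine ⟨fun x hx => ?_, by rwa [hreg], fun x => ?_, fun _ => ⟨hreg.trans hreg', fun x => ?_⟩,
        fun h => absurd h h15⟩
      · rw [Function.update_of_ne (by omega)]
        exact hlow x hx
      · rw [Function.update_apply]
        split_ifs
        · norm_num
        · exact hmem x
      · rw [hsplit, Function.update_apply]
        by_cases hx : x = P.code d off V j
        · simp [hx]
        · rw [if_neg (by omega), hA]
          have : ¬ P.code d off V j = x := fun h => hx h.symm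
          simp only [this, false_or]
  · refine ⟨fun _ _ _ => rfl, h18, le_rfl, fun _ _ => rfl, h0, hmem, fun _ => ⟨rfl, fun x => ?_⟩,
      fun _ => ⟨rfl, ?_⟩⟩
    · constructor
      · exact Or.inl
      · rintro (h | ⟨t, ht, ht', -⟩)
        · exact h
        · omega
    · constructor
      · exact Or.inl
      · rintro (h | ⟨t, ht, ht', -⟩)
        · exact h
        · omega
  · rintro s' ⟨hfr, -, -, hlow, h0, hmem, hA, hB⟩
    exact ⟨hfr, hlow, h0, hmem, by simpa using hA, by simpa using hB⟩

/-- The offset of the lists for a row that is followed by `k` more rows. -/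
def offset (P : Params) (n k : ℕ) : ℕ := if n ≤ k then 0 else 2 ^ P.m

/-- A bound for the time that one row takes. -/
def rowTime (P : Params) (d : ℕ) : ℕ := 12 * d + P.count d * (P.blocks d * 28 + 23) + 20

lemma exec_rowStep (hw : P.Fits w n d) (hR : P.Consts n d R) {p k V : ℕ} (h13 : R 13 = k + 1)
    (hk : k < 2 ^ w) (h14 : R 14 = p) (hp : p + d ≤ base n d) (hV : packBits mem d p 0 = V)
    (hV' : V < 2 ^ d) (h0 : R 0 < 2) (hmem : ∀ x, mem (base n d + x) < 2) :
    Exec w (block rowStep) ⟨R, mem⟩ (rowTime P d) fun s' =>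
      (∀ r < 13, r ≠ 0 → s'.regs r = R r) ∧ s'.regs 13 = k ∧ s'.regs 14 = p + d ∧
      (∀ x < base n d, s'.mem x = mem x) ∧ s'.regs 0 < 2 ∧ (∀ x, s'.mem (base n d + x) < 2) ∧
      (n ≤ k → s'.regs 0 = R 0 ∧ ∀ x, s'.mem (base n d + x) ≠ 0 ↔
        mem (base n d + x) ≠ 0 ∨ ∃ t < P.count d, P.code d 0 V t = x) ∧
      (¬ n ≤ k → s'.mem = mem ∧ (s'.regs 0 ≠ 0 ↔
        R 0 ≠ 0 ∨ ∃ t < P.count d, mem (base n d + P.code d (2 ^ P.m) V t) ≠ 0)) := by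
  have hs := hw.space
  have hvec := hw.vector
  have hpos : 0 < (2 ^ P.s) ^ P.blocks d := by positivity
  have hbase : 2 ≤ base n d := by unfold base; omega
  have hm : 2 ^ P.m < 2 ^ w := by
    have h1 := hw.index
    have h2 : 2 ^ P.m + 2 ^ P.m ≤ (2 ^ P.m + 2 ^ P.m) * 2 ^ P.e :=
      Nat.le_mul_of_pos_right _ (by positivity)
    have h3 : (2 ^ P.m + 2 ^ P.m) * 2 ^ P.e ≤ (2 ^ P.m + 2 ^ P.m) * 2 ^ P.e * (P.s + 1) :=
      Nat.le_mul_of_pos_right _ (by omega)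
    omega
  have hd : d < 2 ^ d := Nat.lt_two_pow_self
  unfold rowStep rowTime
  set U := P.count d * (P.blocks d * 28 + 23) with hU
  -- With `k` rows left after the current one out of `2n`, the current row belongs to `A` exactly
  -- when `n ≤ k`.
  have hlt : Op.eval .lt (R 10) (R 13) = if n ≤ k then 1 else 0 := by
    simp [Op.eval, hR.r10, h13]
  refine Exec.op_cons (T := 12 * d + U + 18) _ hlt (by split_ifs <;> omega) ?_
  refine (Exec.block_cons (T := 4) (T' := 12 * d + U + 13) ?_).mono (by omega) fun _ h => h
  have hite : Exec w (.ite 15 (block [.const 17 0]) (block [.op .or 17 2 2]))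
      ⟨Function.update R 15 (if n ≤ k then 1 else 0), mem⟩ 4 fun s' => s'.mem = mem ∧
      (∀ r < 20, r ≠ 15 → r ≠ 17 → s'.regs r = R r) ∧
      s'.regs 15 = (if n ≤ k then 1 else 0) ∧ s'.regs 17 = offset P n k := by
    refine Exec.ite (T := 3) (fun h => ?_) fun h => ?_
    · have hnk : n ≤ k := by
        by_contra hnk
        simp [hnk] at h
      refine Exec.const_cons (by positivity) (Exec.block_nil (T := 0) ⟨rfl, fun r _ h h' => ?_, ?_, ?_⟩)
      · simp (disch := omega) only [Function.update_of_ne]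
      · simp
      · simp [offset, hnk]
    · have hnk : ¬ n ≤ k := by
        intro hnk
        simp [hnk] at h
      refine Exec.op_cons (2 ^ P.m) (by simp [Op.eval, hR.r2]) hm
        (Exec.block_nil (T := 0) ⟨rfl, fun r _ h h' => ?_, ?_, ?_⟩)
      · simp (disch := omega) only [Function.update_of_ne]
      · simp
      · simp [offset, hnk]
  refine hite.mono le_rfl ?_
  rintro ⟨R₁, mem₁⟩ ⟨hm₁, hfr₁, h15₁, h17₁⟩
  simp only at hm₁ hfr₁ h15₁ h17₁
  subst hm₁
  refine (Exec.const_cons (T := 12 * d + U + 11) (by positivity) ?_)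
  refine (Exec.op_cons (T := 12 * d + U + 9) d
    (by simp [Op.eval, hfr₁ 11 (by norm_num) (by norm_num) (by norm_num), hR.r11]) (by omega) ?_)
  refine (Exec.block_cons (T := d * 12 + 1) (T' := U + 7) ?_).mono (by omega) fun _ h => h
  refine (exec_pack (p := p) (acc := 0) (k := d) (hR.congr fun r hr _ => ?_) ?_ (by simp)
    (by simp) (by omega) (by omega) (by omega)).mono le_rfl ?_
  · simp (disch := omega) only [Function.update_of_ne]
    exact hfr₁ r (by omega) (by omega) (by omega)
  · simpa using (hfr₁ 14 (by norm_num) (by norm_num) (by norm_num)).trans h14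
  rintro ⟨R₂, mem₂⟩ ⟨hm₂, hfr₂, h14₂, h16₂⟩
  simp only at hm₂ hfr₂ h14₂ h16₂
  subst hm₂
  have hfr₃ : ∀ r < 18, r ≠ 14 → r ≠ 16 → R₂ r = R₁ r := fun r hr h h' => by
    rw [hfr₂ r hr h h']
    simp (disch := omega) only [Function.update_of_ne]
  have hfr₄ : ∀ r < 14, R₂ r = R r := fun r hr =>
    (hfr₃ r (by omega) (by omega) (by omega)).trans (hfr₁ r (by omega) (by omega) (by omega))
  refine (Exec.op_cons (T := U + 5) (P.count d)
    (by simp [Op.eval, hfr₄ 8 (by norm_num), hR.r8]) hw.count ?_)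
  refine (Exec.block_cons (T := U + 1) (T' := 3) ?_).mono (by omega) fun _ h => h
  refine (exec_codes (off := offset P n k) (V := V) hw
    (hR.congr fun r hr _ => ?_) ?_ ?_ ?_ (by omega) (by simp) ?_ hmem).mono le_rfl ?_
  · simp (disch := omega) only [Function.update_of_ne]
    exact hfr₄ r (by omega)
  · simpa using (hfr₃ 17 (by norm_num) (by norm_num) (by norm_num)).trans h17₁
  · unfold offset
    split_ifs
    exacts [Nat.zero_le _, le_rfl]
  · simpa using h16₂.trans hV
  · simpa [hfr₄ 0 (by norm_num)] using h0
  rintro ⟨R₃, mem₃⟩ ⟨hfr₅, hlow, h0₃, hmem₃, hA, hB⟩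
  simp only at hfr₅ hlow h0₃ hmem₃ hA hB
  have e15 : Function.update R₂ 18 (P.count d) 15 = if n ≤ k then 1 else 0 := by
    simpa using (hfr₃ 15 (by norm_num) (by norm_num) (by norm_num)).trans h15₁
  have e0 : Function.update R₂ 18 (P.count d) 0 = R 0 := by simpa using hfr₄ 0 (by norm_num)
  rw [e15, e0] at hA hB
  have hfr₆ : ∀ r < 14, r ≠ 0 → R₃ r = R r := fun r hr h => by
    rw [hfr₅ r (by omega) h, Function.update_of_ne (by omega), hfr₄ r hr]
  have h14₃ : R₃ 14 = p + d := by
    rw [hfr₅ 14 (by norm_num) (by norm_num), Function.update_of_ne (by norm_num), h14₂]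
  refine Exec.op_cons k (by simp [Op.eval, hfr₆ 13 (by norm_num) (by norm_num), h13,
    hfr₆ 1 (by norm_num) (by norm_num), hR.r1]) hk (Exec.block_nil (T := 0) ?_)
  refine ⟨fun r hr h => ?_, by simp, by simpa using h14₃, hlow, by simpa using h0₃, hmem₃,
    fun hnk => ?_, fun hnk => ?_⟩
  · simp only
    rw [Function.update_of_ne (by omega)]
    exact hfr₆ r (by omega) h
  · obtain ⟨h1, h2⟩ := hA (by simp [hnk])
    refine ⟨by simpa using h1, ?_⟩
    simpa only [offset, if_pos hnk] using h2
  · obtain ⟨h1, h2⟩ := hB (by simp [hnk])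
    refine ⟨h1, ?_⟩
    simpa [offset, hnk] using h2

end Params

end OrthogonalVectors

/-! ### The run on a whole instance, the word length and the running time -/

namespace OrthogonalVectors

open WordRAM

lemma packBits_congr {f g : ℕ → ℕ} (n p acc : ℕ) (h : ∀ j < n, f (p + j) = g (p + j)) :
    packBits f n p acc = packBits g n p acc := by
  induction n generalizing p acc with
  | zero => rfl
  | succ n ih =>
    have h0 : f p = g p := h 0 (by omega)
    rw [packBits, packBits, h0]
    refine ih _ _ fun j hj => ?_
    rw [show p + 1 + j = p + (j + 1) by omega]
    exact h _ (by omega)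

namespace Params

variable {P : Params} {w n d : ℕ} {R : ℕ → ℕ}

lemma exec_rows (hw : P.Fits w n d) (A B : Fin n → Finset (Fin d)) (hR : P.Consts n d R)
    (h0 : R 0 = 0) (h13 : R 13 = n + n) (h14 : R 14 = 2) :
    Exec w (.loop 13 (block rowStep)) ⟨R, inputMem A B⟩ ((n + n) * (rowTime P d + 1) + 1)
      fun s' => s'.regs 0 ≠ 0 ↔ ∃ i, n ≤ i ∧ i < n + n ∧ ∃ t < P.count d, ∃ i' < n,
        ∃ t' < P.count d, P.code d 0 (row A B i') t' = P.code d (2 ^ P.m) (row A B i) t := by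
  -- `ρ` is the index of the next row. The marked cells are the codes of the rows of `A` read so
  -- far, and the answer is set once a row of `B` has hit one of them; all rows of `A` come before
  -- those of `B`.
  refine (Exec.loop (T := rowTime P d) (fun k s' => P.Consts n d s'.regs ∧ s'.regs 13 = k ∧
    ∃ ρ, ρ + k = n + n ∧ s'.regs 14 = 2 + ρ * d ∧ (∀ x < base n d, s'.mem x = inputMem A B x) ∧
      s'.regs 0 < 2 ∧ (∀ x, s'.mem (base n d + x) < 2) ∧
      (∀ x, s'.mem (base n d + x) ≠ 0 ↔
        ∃ i' < n, i' < ρ ∧ ∃ t' < P.count d, P.code d 0 (row A B i') t' = x) ∧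
      (s'.regs 0 ≠ 0 ↔ ∃ i, n ≤ i ∧ i < ρ ∧ ∃ t < P.count d, ∃ i' < n,
        ∃ t' < P.count d, P.code d 0 (row A B i') t' = P.code d (2 ^ P.m) (row A B i) t))
    ?_ (fun s' h => h.2.1) (n := n + n) ?_).mono le_rfl ?_
  · rintro k ⟨R', mem⟩ ⟨hC, h13, ρ, hρ, h14, hin, h0, hmem, hmark, hans⟩
    simp only at hC h13 h14 hin h0 hmem hmark hans
    refine ⟨by simp [h13], ?_⟩
    have hrows := hw.rows
    have hp : 2 + ρ * d + d ≤ base n d := by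
      have : (ρ + 1) * d ≤ (n + n) * d := Nat.mul_le_mul_right d (by omega)
      have e1 : (ρ + 1) * d = ρ * d + d := by ring
      have e2 : (n + n) * d = n * d + n * d := by ring
      unfold base
      omega
    refine (exec_rowStep (V := row A B ρ) hw hC h13 (by omega) h14 hp
      (packBits_congr _ _ _ fun j hj => hin _ (by omega)) (row_lt A B ρ) h0 hmem).mono le_rfl ?_
    rintro ⟨R'', mem'⟩ ⟨hfr, h13', h14', hlow, h0', hmem', hA, hB⟩
    simp only at hfr h13' h14' hlow h0' hmem' hA hB
    refine ⟨hC.congr hfr, h13', ρ + 1, by omega, ?_, fun x hx => (hlow x hx).trans (hin x hx), h0',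
      hmem', ?_⟩
    · simp only [h14']
      ring
    simp only
    by_cases hnk : n ≤ k
    · obtain ⟨hreg, hm⟩ := hA hnk
      constructor
      · intro x
        rw [hm, hmark]
        constructor
        · rintro (⟨i', h1, h2, h3⟩ | h)
          · exact ⟨i', h1, by omega, h3⟩
          · exact ⟨ρ, by omega, by omega, h⟩
        · rintro ⟨i', h1, h2, h3⟩
          rcases Nat.lt_succ_iff_lt_or_eq.mp h2 with h | rfl
          · exact Or.inl ⟨i', h1, h, h3⟩
          · exact Or.inr h3
      · rw [hreg, hans]
        constructor <;>
        · rintro ⟨i, h1, h2, -⟩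
          omega
    · obtain ⟨rfl, hreg⟩ := hB hnk
      constructor
      · intro x
        rw [hmark]
        constructor
        · rintro ⟨i', h1, h2, h3⟩
          exact ⟨i', h1, by omega, h3⟩
        · rintro ⟨i', h1, h2, h3⟩
          exact ⟨i', h1, by omega, h3⟩
      · rw [hreg, hans]
        constructor
        · rintro (⟨i, h1, h2, h3⟩ | ⟨t, ht, h⟩)
          · exact ⟨i, h1, by omega, h3⟩
          · obtain ⟨i', h1, -, h2⟩ := (hmark _).mp h
            exact ⟨ρ, by omega, by omega, t, ht, i', h1, h2⟩
        · rintro ⟨i, h1, h2, t, ht, i', hi', h3⟩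
          rcases Nat.lt_succ_iff_lt_or_eq.mp h2 with h | rfl
          · exact Or.inl ⟨i, h1, h, t, ht, i', hi', h3⟩
          · exact Or.inr ⟨t, ht, (hmark _).mpr ⟨i', hi', by omega, h3⟩⟩
  · have hzero : ∀ x, inputMem A B (base n d + x) = 0 := fun x =>
      inputMem_eq_zero A B (by unfold base; omega)
    refine ⟨hR, h13, 0, by omega, by simp [h14], fun _ _ => rfl, by simp [h0], fun x => ?_,
      fun x => ?_, ?_⟩
    · simp [hzero]
    · simp [hzero]
    · simp [h0]
  · rintro s' ⟨-, -, ρ, hρ, -, -, -, -, -, h⟩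
    obtain rfl : ρ = n + n := by omega
    exact h

/-- The lists stored in `T` have common entries exactly for disjoint blocks. -/
def Correct (P : Params) : Prop :=
  ∀ v v', v < 2 ^ P.m → v' < 2 ^ P.m →
    ((∃ x < 2 ^ P.e, ∃ y < 2 ^ P.e, P.tab 0 v x = P.tab (2 ^ P.m) v' y) ↔ v &&& v' = 0)

lemma exists_code_eq_iff (hP : P.Correct) (hm : 0 < P.m) (A B : Fin n → Finset (Fin d)) :
    (∃ i, n ≤ i ∧ i < n + n ∧ ∃ t < P.count d, ∃ i' < n, ∃ t' < P.count d,
      P.code d 0 (row A B i') t' = P.code d (2 ^ P.m) (row A B i) t) ↔ HasOrthogonalPair A B := by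
  -- The `+ 1` in `blocks` ensures that the blocks cover all `d` bits.
  have hrow : ∀ r, row A B r < (2 ^ P.m) ^ P.blocks d := fun r => by
    refine (row_lt A B r).trans_le ?_
    rw [← pow_mul]
    exact Nat.pow_le_pow_right (by norm_num) (Nat.lt_mul_div_succ d hm).le
  have key : ∀ r r', (∃ t < P.count d, ∃ t' < P.count d,
      P.code d 0 (row A B r) t = P.code d (2 ^ P.m) (row A B r') t') ↔
      row A B r &&& row A B r' = 0 := fun r r' => by
    rw [count, pow_mul]
    refine (exists_nodeCode_eq_iff (tab_lt 0) (tab_lt _) (by positivity) hP (P.blocks d) _ _ 0 0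
      (hrow r) (hrow r')).trans ?_
    simp
  constructor
  · rintro ⟨i, h1, h2, t, ht, i', hi', t', ht', h⟩
    refine ⟨⟨i', hi'⟩, ⟨i - n, by omega⟩, ?_⟩
    rw [← row_land_row_eq_zero_iff]
    simp only [Nat.add_sub_cancel' h1]
    exact (key i' i).mp ⟨t', ht', t, ht, h⟩
  · rintro ⟨i, j, h⟩
    rw [← row_land_row_eq_zero_iff, ← key] at h
    obtain ⟨t, ht, t', ht', h⟩ := h
    exact ⟨n + j, by omega, by omega, t', ht', i, i.2, t, ht, h⟩

lemma exec_program (hw : P.Fits w n d) (hP : P.Correct) (hm : 0 < P.m)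
    (A B : Fin n → Finset (Fin d)) :
    Exec w P.program ⟨fun _ => 0, inputMem A B⟩ ((n + n) * (rowTime P d + 1) + 45)
      fun s' => s'.regs 0 ≠ 0 ↔ HasOrthogonalPair A B := by
  have hs := hw.space
  have hb := hw.blocks
  have hi := hw.index
  have hvec := hw.vector
  have hrows := hw.rows
  have hsh := hw.shift
  have hbits := hw.bits
  have hd : d < 2 ^ d := Nat.lt_two_pow_self
  have hss : P.s < 2 ^ P.s := Nat.lt_two_pow_self
  have hpos : 0 < (2 ^ P.s) ^ P.blocks d := by positivity
  have hpm : 0 < 2 ^ P.m := by positivity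
  have hpe : 0 < 2 ^ P.e := by positivity
  have h2 : (2 ^ P.m + 2 ^ P.m) * 2 ^ P.e ≤ (2 ^ P.m + 2 ^ P.m) * 2 ^ P.e * (P.s + 1) :=
    Nat.le_mul_of_pos_right _ (by omega)
  have h3 : 2 ^ P.m + 2 ^ P.m ≤ (2 ^ P.m + 2 ^ P.m) * 2 ^ P.e := Nat.le_mul_of_pos_right _ hpe
  have h4 : 2 ^ P.e ≤ (2 ^ P.m + 2 ^ P.m) * 2 ^ P.e := Nat.le_mul_of_pos_left _ (by omega)
  have hee : P.e < 2 ^ P.e := Nat.lt_two_pow_self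
  have hbase : base n d = n * d + n * d + 1 + 1 := rfl
  have hblocks : P.blocks d = d / P.m + 1 := rfl
  set L := (n + n) * (rowTime P d + 1) with hL
  unfold program
  refine Exec.const_cons (T := L + 43) (by omega) ?_
  refine Exec.const_cons (T := L + 41) (by omega) ?_
  refine Exec.const_cons (T := L + 39) (by omega) ?_
  refine Exec.const_cons (T := L + 37) (by omega) ?_
  refine Exec.const_cons (T := L + 35) (by omega) ?_
  refine Exec.const_cons (T := L + 33) hw.table ?_
  refine Exec.const_cons (T := L + 31) (by omega) ?_
  refine Exec.load_cons (T := L + 29) n (by simp [inputMem]) (by omega) ?_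
  refine Exec.load_cons (T := L + 27) d (by simp [inputMem]) (by omega) ?_
  refine Exec.op_cons (T := L + 25) (n * d) (by simp [Op.eval]) (by omega) ?_
  refine Exec.op_cons (T := L + 23) (n * d + n * d) (by simp [Op.eval]) (by omega) ?_
  refine Exec.op_cons (T := L + 21) (n * d + n * d + 1) (by simp [Op.eval]) (by omega) ?_
  refine Exec.op_cons (T := L + 19) (base n d) (by simp [Op.eval, base]) (by omega) ?_
  refine Exec.const_cons (T := L + 17) hw.length ?_
  refine Exec.op_cons (T := L + 15) (d / P.m) (by simp [Op.eval]) (by omega) ?_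
  refine Exec.op_cons (T := L + 13) (P.blocks d) (by simp [Op.eval, blocks]) (by omega) ?_
  refine Exec.const_cons (T := L + 11) (by omega) ?_
  refine Exec.op_cons (T := L + 9) (P.e * P.blocks d) (by simp [Op.eval]) hsh ?_
  refine Exec.op_cons (T := L + 7) (P.count d) (by simp [Op.eval, count, Nat.shiftLeft_eq])
    hw.count ?_
  refine Exec.op_cons (T := L + 5) (n + n) (by simp [Op.eval]) hrows ?_
  refine Exec.const_cons (T := L + 3) (by omega) ?_
  refine (Exec.block_cons (T := L + 1) (T' := 1) ?_).mono (by omega) fun _ h => h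
  refine (exec_rows hw A B ?_ (by simp) (by simp) (by simp)).mono le_rfl fun s' h =>
    Exec.block_nil (T := 0) (h.trans (exists_code_eq_iff hP hm A B))
  constructor <;> simp

/-- The word length that suffices, as a multiple of `d + log n + 1`. -/
def wordFactor (P : Params) : ℕ :=
  (2 ^ P.m + 2 ^ P.m) * 2 ^ P.e * (P.s + 1) + P.T + P.m + P.s + P.e + 8

lemma fits (hw : P.wordFactor * (d + Nat.log 2 n + 1) ≤ w) : P.Fits w n d := by
  set D := d + Nat.log 2 n + 1 with hD
  unfold wordFactor at hw
  set I := (2 ^ P.m + 2 ^ P.m) * 2 ^ P.e * (P.s + 1) with hI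
  have hdist : (I + P.T + P.m + P.s + P.e + 8) * D =
      I * D + P.T * D + P.m * D + P.s * D + P.e * D + 8 * D := by ring
  rw [hdist] at hw
  have hD1 : 1 ≤ D := by omega
  have le_mul : ∀ x, x ≤ x * D := fun x => Nat.le_mul_of_pos_right x hD1
  have l1 := le_mul I
  have l2 := le_mul P.T
  have l3 := le_mul P.m
  have l4 := le_mul P.s
  have hww : w < 2 ^ w := Nat.lt_two_pow_self
  have hblocks : P.blocks d ≤ D := by
    have : d / P.m ≤ d := Nat.div_le_self _ _
    unfold blocks
    omega
  have heb : P.e * P.blocks d ≤ P.e * D := Nat.mul_le_mul_left _ hblocks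
  have hsb : P.s * P.blocks d ≤ P.s * D := Nat.mul_le_mul_left _ hblocks
  have hlt : ∀ {x}, x < w → 2 ^ x < 2 ^ w := fun h => Nat.pow_lt_pow_right (by norm_num) h
  have hn : n < 2 ^ (Nat.log 2 n + 1) := Nat.lt_pow_succ_log_self (by norm_num) n
  refine ⟨by omega, by omega, ?_, hlt (by omega), by omega, by omega, hlt (by omega), ?_,
    by omega, hlt (by omega)⟩
  · have hd : d < 2 ^ d := Nat.lt_two_pow_self
    have h1 : n * d ≤ 2 ^ (Nat.log 2 n + 1) * 2 ^ d := Nat.mul_le_mul hn.le hd.le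
    rw [← pow_add, show Nat.log 2 n + 1 + d = D by omega] at h1
    have h2 : 2 ^ D ≤ 2 ^ (P.s * D + D) := Nat.pow_le_pow_right (by norm_num) (by omega)
    have h3 : (2 ^ P.s) ^ P.blocks d ≤ 2 ^ (P.s * D + D) := by
      rw [← pow_mul]
      exact Nat.pow_le_pow_right (by norm_num) (by omega)
    have h4 : 2 ^ (P.s * D + D + 3) ≤ 2 ^ w := Nat.pow_le_pow_right (by norm_num) (by omega)
    have h5 : 2 ^ 1 ≤ 2 ^ (P.s * D + D) := Nat.pow_le_pow_right (by norm_num) (by omega)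
    rw [pow_add] at h4
    unfold base
    omega
  · have h1 : 2 ^ (Nat.log 2 n + 1 + 1) ≤ 2 ^ w := Nat.pow_le_pow_right (by norm_num) (by omega)
    rw [pow_succ] at h1
    omega

lemma time_le (he : (2 : ℝ) ^ P.e ≤ 1.1599 ^ P.m) (hn : 1 ≤ n) :
    (((n + n) * (rowTime P d + 1) + 45 : ℕ) : ℝ) ≤ 213 * 11599 * 2 ^ P.e * 1.16 ^ d * n := by
  have hcount : (P.count d : ℝ) ≤ 2 ^ P.e * 1.1599 ^ d := by
    have h1 : P.count d = 2 ^ P.e * (2 ^ P.e) ^ (d / P.m) := by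
      rw [count, blocks, pow_mul, pow_succ, mul_comm]
    rw [h1]
    push_cast
    gcongr
    calc ((2 : ℝ) ^ P.e) ^ (d / P.m) ≤ (1.1599 ^ P.m) ^ (d / P.m) := by gcongr
      _ = 1.1599 ^ (P.m * (d / P.m)) := by rw [pow_mul]
      _ ≤ 1.1599 ^ d := pow_le_pow_right₀ (by norm_num) (Nat.mul_div_le d P.m)
  have hblocks : (P.blocks d : ℝ) ≤ d + 1 := by
    have : P.blocks d ≤ d + 1 := Nat.succ_le_succ (Nat.div_le_self _ _)
    exact_mod_cast this
  -- Bernoulli's inequality for `1.16 / 1.1599 = 1 + 1 / 11599` absorbs the factor `d + 1`.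
  have hbern : (d : ℝ) + 1 ≤ 11599 * (1.16 / 1.1599) ^ d := by
    have := one_add_mul_le_pow (show (-2 : ℝ) ≤ 1 / 11599 by norm_num) d
    rw [show (1 : ℝ) + 1 / 11599 = 1.16 / 1.1599 by norm_num] at this
    linarith
  have hn' : (1 : ℝ) ≤ n := by exact_mod_cast hn
  have hz : (1 : ℝ) ≤ 2 ^ P.e * 1.1599 ^ d :=
    one_le_mul_of_one_le_of_one_le (one_le_pow₀ (by norm_num)) (one_le_pow₀ (by norm_num))
  have hd : (0 : ℝ) ≤ d := by positivity
  set z : ℝ := 2 ^ P.e * 1.1599 ^ d with hzdef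
  have hzd : (d : ℝ) + 1 ≤ z * (d + 1) := by nlinarith
  -- `84 = 12 + 28 + 23 + 21`; below, `213 = 2 * 84 + 45`.
  have hrow : (rowTime P d : ℝ) + 1 ≤ 84 * (z * (d + 1)) := by
    unfold rowTime
    push_cast
    have h1 : (P.count d : ℝ) * (P.blocks d * 28 + 23) ≤ z * ((d + 1) * 28 + 23) := by gcongr
    nlinarith
  have hdecomp : z * (d + 1) ≤ 11599 * 2 ^ P.e * 1.16 ^ d := by
    calc z * (d + 1) ≤ z * (11599 * (1.16 / 1.1599) ^ d) := by gcongr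
      _ = 11599 * 2 ^ P.e * (1.1599 ^ d * (1.16 / 1.1599) ^ d) := by rw [hzdef]; ring
      _ = _ := by rw [← mul_pow]; norm_num
  push_cast
  calc ((n : ℝ) + n) * (rowTime P d + 1) + 45
      ≤ (n + n) * (84 * (z * (d + 1))) + 45 * (n * (z * (d + 1))) := by
        gcongr
        nlinarith
    _ = 213 * n * (z * (d + 1)) := by ring
    _ ≤ 213 * n * (11599 * 2 ^ P.e * 1.16 ^ d) := by gcongr
    _ = _ := by ring

end Params

/-- There are tables for which the program is correct and fast. -/
lemma exists_params : ∃ P : Params, 0 < P.m ∧ (2 : ℝ) ^ P.e ≤ 1.1599 ^ P.m ∧ P.Correct := by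
  obtain ⟨m, e, s, f, g, hm, he, hf, hg, h⟩ := DisjointnessCover.exists_cover
  -- The `2 ^ m` lists of `f` come first, then those of `g`, each occupying `2 ^ e` consecutive
  -- entries.
  obtain ⟨T, hT⟩ := exists_table s ((2 ^ m + 2 ^ m) * 2 ^ e)
    (fun i => if i / 2 ^ e < 2 ^ m then f (i / 2 ^ e) (i % 2 ^ e)
      else g (i / 2 ^ e - 2 ^ m) (i % 2 ^ e)) fun i => by
        split_ifs
        exacts [hf _ _, hg _ _]
  have hpe : 0 < 2 ^ e := by positivity
  have hidx : ∀ v x, v < 2 ^ m + 2 ^ m → x < 2 ^ e → v * 2 ^ e + x < (2 ^ m + 2 ^ m) * 2 ^ e :=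
    fun v x hv hx => by
      calc v * 2 ^ e + x < v * 2 ^ e + 2 ^ e := by omega
        _ = (v + 1) * 2 ^ e := by ring
        _ ≤ _ := Nat.mul_le_mul_right _ hv
  have hdiv : ∀ v x, x < 2 ^ e → (v * 2 ^ e + x) / 2 ^ e = v := fun v x hx => by
    rw [mul_comm, Nat.mul_add_div hpe, Nat.div_eq_of_lt hx, add_zero]
  have hmod : ∀ v x, x < 2 ^ e → (v * 2 ^ e + x) % 2 ^ e = x := fun v x hx => by
    rw [mul_comm, Nat.mul_add_mod, Nat.mod_eq_of_lt hx]
  refine ⟨⟨m, e, s, T⟩, hm, he, fun v v' hv hv' => ?_⟩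
  simp only at hv hv' ⊢
  rw [← h v v' hv hv']
  have h1 : ∀ x < 2 ^ e, Params.tab ⟨m, e, s, T⟩ 0 v x = f v x := fun x hx => by
    simp only [Params.tab, zero_add]
    rw [hT _ (hidx v x (by omega) hx), hdiv v x hx, hmod v x hx, if_pos hv]
  have h2 : ∀ x < 2 ^ e, Params.tab ⟨m, e, s, T⟩ (2 ^ m) v' x = g v' x := fun x hx => by
    simp only [Params.tab]
    rw [hT _ (hidx _ x (by omega) hx), hdiv _ x hx, hmod _ x hx, if_neg (by omega),
      Nat.add_sub_cancel_left]
  constructor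
  · rintro ⟨x, hx, y, hy, hxy⟩
    exact ⟨x, hx, y, hy, by rw [← h1 x hx, ← h2 y hy, hxy]⟩
  · rintro ⟨x, hx, y, hy, hxy⟩
    exact ⟨x, hx, y, hy, by rw [h1 x hx, h2 y hy, hxy]⟩

/-- The program runs in time `O(1.16 ^ d * n)` and never errs. -/
theorem exists_decides : ∃ (P : Cmd) (κ : ℕ) (C : ℝ), 0 ≤ C ∧ ∀ err : ℕ → ℝ, (∀ d, 0 ≤ err d) →
    Decides P κ (fun n d => C * (1.16 : ℝ) ^ d * n) err := by
  obtain ⟨P, hm, he, hP⟩ := exists_params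
  refine ⟨P.program, P.wordFactor, 213 * 11599 * 2 ^ P.e, by positivity,
    fun err herr n d w A B hn _ _ hw => ?_⟩
  obtain ⟨t, ht, s', hrun, hs'⟩ := Params.exec_program (Params.fits hw) hP hm A B
  -- The output distribution is a point mass, so the acceptance probability is `0` or `1`.
  have hrun' : run w t (initConfig P.program A B) = PMF.pure ([], s') := hrun []
  have hprob : acceptProb w t (initConfig P.program A B) = if s'.regs 0 ≠ 0 then 1 else 0 := by
    rw [acceptProb, hrun', PMF.toOuterMeasure_pure_apply]
    by_cases h0 : s'.regs 0 = 0 <;> simp [h0]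
  refine ⟨t, le_trans (by exact_mod_cast ht) (Params.time_le he hn), fun c' hc' => ?_,
    fun hno => ?_, fun hyes => ?_⟩
  · rw [hrun', PMF.support_pure, Set.mem_singleton_iff] at hc'
    rw [hc']
  · rw [hprob, if_neg fun h => hno (hs'.mp h)]
  · rw [hprob, if_pos (hs'.mpr hyes)]
    linarith [herr d]

end OrthogonalVectors

theorem theorem1 :
    (∃ (P : WordRAM.Cmd) (κ k : ℕ) (C ε : ℝ), 0 < ε ∧
      OrthogonalVectors.Decides P κ
        (fun n d => C * (1.25 : ℝ) ^ d * n * ((d : ℝ) + Nat.log 2 n + 1) ^ k)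
        (fun d => (2 : ℝ) ^ (-(d : ℝ) ^ ε))) ∧
    (∃ (P : WordRAM.Cmd) (κ : ℕ) (C ε : ℝ), 0 < ε ∧
      OrthogonalVectors.Decides P κ
        (fun n d => C * (1.16 : ℝ) ^ d * n)
        (fun d => (2 : ℝ) ^ (-(d : ℝ) ^ ε))) := by
  obtain ⟨P, κ, C, hC, h⟩ := OrthogonalVectors.exists_decides
  have h' := h (fun d => (2 : ℝ) ^ (-(d : ℝ) ^ (1 : ℝ))) fun d => by positivity
  -- The same program serves for both parts: `1.16 ≤ 1.25`, with no logarithmic factor (`k = 0`),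
  -- and `ε = 1` is admissible because the error is zero.
  refine ⟨⟨P, κ, 0, C, 1, one_pos, fun n d w A B hn hA hB hw => ?_⟩, P, κ, C, 1, one_pos, h'⟩
  obtain ⟨t, ht, hrest⟩ := h' n d w A B hn hA hB hw
  refine ⟨t, ht.trans ?_, hrest⟩
  simp only [pow_zero, mul_one]
  gcongr
  norm_num
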